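/- Conventions. Let $\mathcal A$ be an abelian length category, i.e. an abelian category in which every object satisfies the ascending and the descending chain condition on subobjects. A length function on $\mathcal A$ is a map $\lambda$ from the objects of $\mathcal A$ to $[0,\infty)$ such that $\lambda(X)=0$ if and only if $X=0$, and $\lambda(Y_2)=\lambda(Y_1)+\lambda(Y_3)$ for every short exact sequence $0\to Y_1\to Y_2\to Y_3\to 0$. Order the finite subsets of $[0,\infty)$ totally by $I<J$ if $I\neq J$ and $\min\big((I\setminus J)\cup(J\setminus I)\big)\in J$. For an indecomposable object $Y$, let $\mu_\lambda(Y)$ be the maximum of the sets $\{\lambda(Y_1),\dots,\lambda(Y_t)\}$, where $Y_1\subset\cdots\subset Y_t$ runs through the finite chains of indecomposable subobjects of $Y$; for indecomposable $Y_1,\dots,Y_t$ put $\mu_\lambda(Y_1\oplus\cdots\oplus Y_t)=\max_i\mu_\lambda(Y_i)$, and $\mu_\lambda(0)=\emptyset$. Let $\mathcal A(<I)$ be the class of indecomposable objects $T$ with $\mu_\lambda(T)<I$. For a class $\Theta$ of objects, $\operatorname{Rej}(X,\Theta)$ is the intersection of the kernels of all morphisms $X\to T$ with $T\in\Theta$.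 The category $\operatorname{add}\overline X$ consists of the direct summands of finite direct sums of copies of $\overline X$. All modules are left modules. The top of a module $M$ is $M/\operatorname{rad}M$, where $\operatorname{rad} M$ is the intersection of the maximal submodules of $M$. Let $\Gamma$ be a semiprimary ring whose simple modules (up to isomorphism) are labelled by a poset $(\Phi,\le)$, and let $P_Y$ be the indecomposable projective module whose top is the simple module labelled by $Y\in\Phi$. Put $\Delta_Y=P_Y/U_Y$, where $U_Y$ is the sum of the images of all homomorphisms $P_Z\to P_Y$ with $Z\not\le Y$. The ring $\Gamma$ is quasihereditary with respect to $(\Phi,\le)$ if for every $Y\in\Phi$ the module $U_Y$ has a finite filtration with subquotients of the form $\Delta_Z$, $Z>Y$, and every nonzero homomorphism $P_Y\to\Delta_Y$ is surjective. A semiprimary ring is left strongly quasihereditary if, for some such poset, it is quasihereditary and every $\Delta_Y$ has projective dimension at most $1$. Statement. Let $\lambda$ be a length function on an abelian length category $\mathcal A$ and let $X$ be an object of $\mathcal A$. Put $X_1=X$ and $$X_{i+1}=X_i/\operatorname{Rej}\big(X_i,\mathcal A(<\mu_\lambda(X_i))\big)\qquad(i\ge 1).$$ Then only finitely many $X_i$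 are nonzero; if $\ell\ge 0$ is their number, then $X_i\ne 0$ if and only if $i\le\ell$. Put $\overline X=\bigoplus_{i=1}^{\ell}X_i$ and $\Gamma=\operatorname{End}_{\mathcal A}(\overline X)$. Then $\Gamma$ is a left strongly quasihereditary ring, and its global dimension is at most $\ell$. Moreover, every nonzero object $Y$ of $\operatorname{add}\overline X$ satisfies $\mu_\lambda(Y)=\mu_\lambda(X_i)$ for exactly one $i$ with $1\le i\le\ell$; and if every indecomposable direct summand $Z$ of $Y$ satisfies $\mu_\lambda(Z)=\mu_\lambda(Y)$ (for example, if $Y$ is indecomposable), then the top of the left $\Gamma$-module $\operatorname{Hom}_{\mathcal A}(Y,\overline X)$ has projective dimension at most this $i$. -/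

import Mathlib

open CategoryTheory CategoryTheory.Limits
open scoped NNReal

universe v u

namespace GabrielRoiter

noncomputable section

/-! ### Abelian length categories and length functions -/

/-- An abelian category is a length category if every object satisfies the ascending and the
descending chain condition on subobjects. -/
class IsLengthCategory (C : Type u) [Category.{v} C] [Abelian C] : Prop where
  noetherian : ∀ X : C, IsNoetherianObject X
  artinian : ∀ X : C, IsArtinianObject X

/-- A length function: a map from the objects to `[0, ∞)`, zero exactly on zero objects and additive
on short exact sequences. (Additivity makes it invariant under isomorphism.) -/
structure LengthFunction (C : Type u) [Category.{v} C] [Abelian C] where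
  toFun : C → ℝ≥0
  eq_zero_iff : ∀ X : C, toFun X = 0 ↔ IsZero X
  additive : ∀ S : ShortComplex C, S.ShortExact → toFun S.X₂ = toFun S.X₁ + toFun S.X₃

/-! ### The totally ordered set of finite subsets of `[0, ∞)` -/

/-- Finite subsets of `[0, ∞)`, ordered by `I < J` iff the least element of the symmetric
difference of `I` and `J` lies in `J` (see `GRSet.of_lt_of_iff`). The colexicographic order of
Mathlib looks at the largest element of the symmetric difference, hence the order dual. -/
abbrev GRSet : Type := Colex (Finset ℝ≥0ᵒᵈ)

/-- A finite subset of `[0, ∞)`, as an element of the totally ordered set `GRSet`. -/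
def GRSet.of (I : Finset ℝ≥0) : GRSet := toColex (I.map OrderDual.toDual.toEmbedding)

theorem GRSet.of_lt_of_iff (I J : Finset ℝ≥0) :
    GRSet.of I < GRSet.of J ↔
      ∃ h : I ≠ J, (symmDiff I J).min' (Finset.symmDiff_nonempty.2 h) ∈ J := by
  classical
  unfold GRSet.of
  rw [Finset.Colex.lt_iff_exists_forall_lt]
  constructor
  · rintro ⟨a, haJ, haI, ha⟩
    obtain ⟨a, rfl⟩ := OrderDual.toDual.surjective a
    simp only [Finset.mem_map_equiv, OrderDual.toDual_symm_eq, OrderDual.ofDual_toDual,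
      ofColex_toColex] at haJ haI ha
    have hne : I ≠ J := fun h => haI (h ▸ haJ)
    refine ⟨hne, ?_⟩
    have hm := Finset.min'_mem _ (Finset.symmDiff_nonempty.2 hne)
    have hle := Finset.min'_le (symmDiff I J) a (Finset.mem_symmDiff.2 (Or.inr ⟨haJ, haI⟩))
    rcases Finset.mem_symmDiff.1 hm with ⟨h1, h2⟩ | ⟨h1, _⟩
    · exact absurd (ha (OrderDual.toDual _) h1 h2) (not_lt.2 (OrderDual.toDual_le_toDual.2 hle))
    · exact h1
  · rintro ⟨hne, hm⟩
    have hmem := Finset.min'_mem _ (Finset.symmDiff_nonempty.2 hne)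
    set m := (symmDiff I J).min' (Finset.symmDiff_nonempty.2 hne) with hmdef
    have hmI : m ∉ I := by
      rcases Finset.mem_symmDiff.1 hmem with ⟨_, h2⟩ | ⟨_, h2⟩
      · exact absurd hm h2
      · exact h2
    refine ⟨OrderDual.toDual m, by simpa using hm, by simpa using hmI, ?_⟩
    intro b hbI hbJ
    obtain ⟨b, rfl⟩ := OrderDual.toDual.surjective b
    simp only [Finset.mem_map_equiv, OrderDual.toDual_symm_eq, OrderDual.ofDual_toDual,
      ofColex_toColex] at hbI hbJ
    have hle := Finset.min'_le (symmDiff I J) b (Finset.mem_symmDiff.2 (Or.inl ⟨hbI, hbJ⟩))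
    refine OrderDual.toDual_lt_toDual.2 (lt_of_le_of_ne hle ?_)
    rintro rfl
    exact hmI hbI

open Classical in
/-- The maximum of a set of elements of `GRSet`; the empty set if there is no maximum. -/
def GRSet.max (S : Set GRSet) : GRSet :=
  if h : ∃ m, IsGreatest S m then h.choose else GRSet.of ∅

/-! ### The Gabriel-Roiter measure -/

variable {C : Type u} [Category.{v} C] [Abelian C]

/-- `Z` is (isomorphic to) a direct summand of `Y`. -/
def IsSummand (Z Y : C) : Prop := ∃ W : C, Nonempty (Y ≅ Z ⊞ W)

open Classical in
/-- The set `{λ(Y₁), …, λ(Yₜ)}` attached to a finite set `{Y₁, …, Yₜ}` of subobjects of `Y`. -/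
def lengthSet (lam : LengthFunction C) {Y : C} (c : Finset (Subobject Y)) : GRSet :=
  GRSet.of (c.image fun Z : Subobject Y => lam.toFun (Z : C))

/-- The Gabriel-Roiter measure of an indecomposable object `Y`: the maximum of the sets
`{λ(Y₁), …, λ(Yₜ)}` over all finite chains `Y₁ ⊂ ⋯ ⊂ Yₜ` of indecomposable subobjects of `Y`.
(In a length category `λ` takes only finitely many values on the subobjects of `Y`, so that the
maximum exists.) -/
def indecMeasure (lam : LengthFunction C) (Y : C) : GRSet :=
  GRSet.max {I | ∃ c : Finset (Subobject Y), c.Nonempty ∧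
    IsChain (· ≤ ·) (c : Set (Subobject Y)) ∧
    (∀ Z ∈ c, Indecomposable (Z : C)) ∧ I = lengthSet lam c}

/-- The Gabriel-Roiter measure `μ_λ(X)` of an object `X`: the maximum of the measures of its
indecomposable direct summands (the empty set for `X = 0`). -/
def grMeasure (lam : LengthFunction C) (X : C) : GRSet :=
  GRSet.max {I | ∃ Y : C, Indecomposable Y ∧ IsSummand Y X ∧ I = indecMeasure lam Y}

/-- The class `𝒜(< I)` of indecomposable objects of Gabriel-Roiter measure smaller than `I`. -/
def indecLT (lam : LengthFunction C) (I : GRSet) : ObjectProperty C :=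
  fun Y => Indecomposable Y ∧ grMeasure lam Y < I

/-! ### Rejects -/

theorem exists_isGLB_of_wellFoundedLT {α : Type*} [SemilatticeInf α] [OrderTop α]
    [WellFoundedLT α] (S : Set α) : ∃ m, IsGLB S m := by
  classical
  let T : Set α := Set.range fun F : {F : Finset α // (F : Set α) ⊆ S} => F.1.inf id
  obtain ⟨m, ⟨⟨F, hF⟩, rfl⟩, hmin⟩ :=
    WellFounded.has_min (wellFounded_lt (α := α)) T ⟨_, ⟨⟨∅, by simp⟩, rfl⟩⟩
  refine ⟨F.inf id, ?_, ?_⟩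
  · intro a ha
    have h := hmin ((insert a F).inf id)
      ⟨⟨insert a F, by rw [Finset.coe_insert]; exact Set.insert_subset ha hF⟩, rfl⟩
    rw [Finset.inf_insert, id] at h
    by_contra hle
    exact h (lt_of_le_of_ne inf_le_right fun he => hle (inf_eq_right.1 he))
  · intro b hb
    exact Finset.le_inf fun a ha => hb (hF ha)

/-- The kernels, as subobjects of `X`, of all morphisms from `X` to objects in `Θ`. -/
def kernelsInto (Θ : ObjectProperty C) (X : C) : Set (Subobject X) :=
  {K | ∃ (T : C) (_ : Θ T) (f : X ⟶ T), K = kernelSubobject f}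

theorem exists_reject [IsLengthCategory C] (Θ : ObjectProperty C) (X : C) :
    ∃ R : Subobject X, IsGLB (kernelsInto Θ X) R := by
  have := IsLengthCategory.artinian X
  exact exists_isGLB_of_wellFoundedLT _

/-- The reject `Rej(X, Θ)`: the intersection of the kernels of all morphisms from `X` to objects
in `Θ`. -/
def reject [IsLengthCategory C] (Θ : ObjectProperty C) (X : C) : Subobject X :=
  (exists_reject Θ X).choose

theorem isGLB_reject [IsLengthCategory C] (Θ : ObjectProperty C) (X : C) :
    IsGLB (kernelsInto Θ X) (reject Θ X) :=
  (exists_reject Θ X).choose_spec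

/-! ### The sequence of quotients -/

attribute [local instance] Abelian.hasFiniteBiproducts

/-- The quotients of `X` given by `X₁ = X` and `Xᵢ₊₁ = Xᵢ / Rej(Xᵢ, 𝒜(< μ_λ(Xᵢ)))`. Indices are
shifted by one: `quotientSeq lam X i` is `Xᵢ₊₁`. -/
def quotientSeq [IsLengthCategory C] (lam : LengthFunction C) (X : C) : ℕ → C
  | 0 => X
  | i + 1 =>
    cokernel (reject (indecLT lam (grMeasure lam (quotientSeq lam X i)))
      (quotientSeq lam X i)).arrow

/-- The number `ℓ` of nonzero objects in the sequence. -/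
def numNonzero [IsLengthCategory C] (lam : LengthFunction C) (X : C) : ℕ :=
  Set.ncard {i : ℕ | ¬ IsZero (quotientSeq lam X i)}

/-- The object `X̄ = X₁ ⊕ ⋯ ⊕ X_ℓ`. -/
def totalObject [IsLengthCategory C] (lam : LengthFunction C) (X : C) : C :=
  ⨁ fun i : Fin (numNonzero lam X) => quotientSeq lam X i

/-- `Y` lies in `add X`: it is a direct summand of a finite direct sum of copies of `X`. -/
def InAdd (X Y : C) : Prop := ∃ n : ℕ, IsSummand Y (⨁ fun _ : Fin n => X)

/-! ### Left strongly quasihereditary rings (all modules are left modules) -/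

/-- The top `M / rad M` of a module, where `rad M` is the intersection of all maximal submodules. -/
abbrev moduleTop (Γ : Type*) [Ring Γ] (M : Type*) [AddCommGroup M] [Module Γ M] : Type _ :=
  M ⧸ Module.jacobson Γ M

/-- A labelling of the simple modules over a semiprimary ring `Γ` by a set `Φ`, given by the
projective modules `P Y` with simple top: the tops `L Y` of the `P Y` form a complete irredundant
list of the simple `Γ`-modules up to isomorphism. (Over a semiprimary ring a projective module with
simple top is indecomposable and is the projective cover of its top.) -/
structure SimpleLabelling (Γ : Type v) [Ring Γ] (Φ : Type) where
  P : Φ → ModuleCat.{v} Γ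
  projective : ∀ Y, Module.Projective Γ (P Y)
  isSimple_top : ∀ Y, IsSimpleModule Γ (moduleTop Γ (P Y))
  eq_of_iso : ∀ Y Z, Nonempty (moduleTop Γ (P Y) ≃ₗ[Γ] moduleTop Γ (P Z)) → Y = Z
  exists_iso : ∀ (S : Type v) [AddCommGroup S] [Module Γ S], IsSimpleModule Γ S →
    ∃ Y, Nonempty (S ≃ₗ[Γ] moduleTop Γ (P Y))

namespace SimpleLabelling

variable {Γ : Type v} [Ring Γ] {Φ : Type} [PartialOrder Φ] (L : SimpleLabelling Γ Φ)

/-- `U_Y`: the trace in `P_Y` of the modules `P_Z` such that `Z ≤ Y` does not hold. -/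
def U (Y : Φ) : Submodule Γ (L.P Y) :=
  ⨆ (Z : Φ) (_ : ¬ Z ≤ Y) (f : L.P Z →ₗ[Γ] L.P Y), LinearMap.range f

/-- The standard module `Δ_Y = P_Y / U_Y`. -/
abbrev Delta (Y : Φ) : Type v := L.P Y ⧸ L.U Y

/-- `U_Y` has a finite filtration with subquotients of the form `Δ_Z`, `Z > Y`. -/
def IsFiltered (Y : Φ) : Prop :=
  ∃ (n : ℕ) (F : ℕ → Submodule Γ (L.P Y)), F 0 = ⊥ ∧ F n = L.U Y ∧
    ∀ i < n, F i ≤ F (i + 1) ∧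
      ∃ Z : Φ, Y < Z ∧ Nonempty ((F (i + 1) ⧸ (F i).submoduleOf (F (i + 1))) ≃ₗ[Γ] L.Delta Z)

/-- `Γ` is quasihereditary with respect to the labelling poset `Φ`. -/
def IsQuasihereditary : Prop :=
  ∀ Y : Φ, L.IsFiltered Y ∧
    ∀ f : L.P Y →ₗ[Γ] L.Delta Y, f ≠ 0 → Function.Surjective f

end SimpleLabelling

/-- A left strongly quasihereditary ring: a semiprimary ring which is quasihereditary with respect
to some partial order on a set labelling its simple modules, with all standard modules of
projective dimension at most `1`. -/
def IsLeftStronglyQuasihereditary (Γ : Type v) [Ring Γ] : Prop :=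
  IsSemiprimaryRing Γ ∧
    ∃ (Φ : Type) (_ : PartialOrder Φ) (L : SimpleLabelling Γ Φ), L.IsQuasihereditary ∧
      ∀ Y : Φ, HasProjectiveDimensionLE (ModuleCat.of Γ (L.Delta Y)) 1

/-- The (left) global dimension of `Γ` is at most `n`. -/
def GlobalDimensionLE (Γ : Type v) [Ring Γ] (n : ℕ) : Prop :=
  ∀ M : ModuleCat.{v} Γ, HasProjectiveDimensionLE M n

/-- The top of the left `End(X)`-module `Hom(Y, X)`, on which `γ` acts by `f ↦ γ ∘ f`. -/
abbrev homTop (Y X : C) : ModuleCat.{v} (End X) := ModuleCat.of (End X) (moduleTop (End X) (Y ⟶ X))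

end

end GabrielRoiter

attribute [local instance] CategoryTheory.Abelian.hasFiniteBiproducts

namespace GabrielRoiter

section LengthFunctionBasics

variable {C : Type u} [Category.{v} C] [Abelian C]

namespace LengthFunction

variable (lam : LengthFunction C)

theorem eq_add_cokernel {A B : C} (f : A ⟶ B) [Mono f] :
    lam.toFun B = lam.toFun A + lam.toFun (cokernel f) :=
  lam.additive (ShortComplex.mk f (cokernel.π f) (cokernel.condition f))
    { exact := ShortComplex.exact_cokernel f }

theorem eq_kernel_add {A B : C} (f : A ⟶ B) [Epi f] :
    lam.toFun A = lam.toFun (kernel f) + lam.toFun B :=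
  lam.additive (ShortComplex.mk (kernel.ι f) f (kernel.condition f))
    { exact := ShortComplex.exact_kernel f }

theorem le_of_mono {A B : C} (f : A ⟶ B) [Mono f] : lam.toFun A ≤ lam.toFun B := by
  rw [lam.eq_add_cokernel f]; exact le_self_add

theorem eq_of_iso {A B : C} (e : A ≅ B) : lam.toFun A = lam.toFun B :=
  le_antisymm (lam.le_of_mono e.hom) (lam.le_of_mono e.inv)

theorem isIso_of_mono {A B : C} (f : A ⟶ B) [Mono f] (h : lam.toFun B ≤ lam.toFun A) :
    IsIso f := by
  have h1 : lam.toFun (cokernel f) = 0 := by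
    have h2 := lam.eq_add_cokernel f
    rw [h2] at h
    simpa using h
  have h3 : cokernel.π f = 0 := ((lam.eq_zero_iff _).1 h1).eq_of_tgt _ _
  have : Epi f := Preadditive.epi_of_cokernel_zero h3
  exact isIso_of_mono_of_epi f

theorem isIso_of_epi {A B : C} (f : A ⟶ B) [Epi f] (h : lam.toFun A ≤ lam.toFun B) :
    IsIso f := by
  have h1 : lam.toFun (kernel f) = 0 := by
    have h2 := lam.eq_kernel_add f
    rw [h2] at h
    simpa using h
  have h3 : kernel.ι f = 0 := ((lam.eq_zero_iff _).1 h1).eq_of_src _ _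
  have : Mono f := Preadditive.mono_of_kernel_zero h3
  exact isIso_of_mono_of_epi f

end LengthFunction

end LengthFunctionBasics

section Induction

variable {C : Type u} [Category.{v} C] [Abelian C] [IsLengthCategory C]

/-- Induction along proper subobjects in a length category. -/
theorem subobject_induction {P : C → Prop}
    (h : ∀ Y : C, (∀ (W : C) (m : W ⟶ Y), Mono m → ¬ IsIso m → P W) → P Y) (Y : C) : P Y := by
  have := IsLengthCategory.artinian Y
  have key : ∀ (S : Subobject Y) (W : C) (m : W ⟶ Y) (_ : Mono m), Subobject.mk m = S → P W := by
    intro S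
    induction S using WellFoundedLT.induction with
    | ind S ih =>
      rintro W m hm rfl
      refine h W fun V k hk hki => ?_
      refine ih (Subobject.mk (k ≫ m)) ?_ V (k ≫ m) inferInstance rfl
      refine lt_of_le_of_ne (Subobject.mk_le_mk_of_comm k rfl) fun he => hki ?_
      have h1 : Subobject.ofMkLEMk m (k ≫ m) he.symm.le ≫ k = 𝟙 W := by
        rw [← cancel_mono m]; simp
      have : IsSplitEpi k := ⟨⟨_, h1⟩⟩
      exact isIso_of_mono_of_epi k
  exact key ⊤ Y (𝟙 Y) inferInstance rfl

/-- Induction along proper quotients in a length category. -/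
theorem quotient_induction {P : C → Prop}
    (h : ∀ Y : C, (∀ (Q : C) (q : Y ⟶ Q), Epi q → ¬ IsIso q → P Q) → P Y) (Y : C) : P Y := by
  have := IsLengthCategory.noetherian Y
  have key : ∀ (S : Subobject Y) (W : C) (q : Y ⟶ W) (_ : Epi q), kernelSubobject q = S → P W := by
    intro S
    induction S using WellFoundedGT.induction with
    | ind S ih =>
      rintro W q hq rfl
      refine h W fun V k hk hki => ?_
      refine ih (kernelSubobject (q ≫ k)) ?_ V (q ≫ k) inferInstance rfl
      refine lt_of_le_of_ne (kernelSubobject_comp_le q k) fun he => hki ?_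
      have : Mono k := by
        refine Preadditive.mono_of_cancel_zero k fun {A} g hg => ?_
        have h1 : pullback.fst q g ≫ q = 0 := by
          have h2 : pullback.fst q g ≫ q ≫ k = 0 := by
            rw [pullback.condition_assoc, hg, comp_zero]
          have h3 : (kernelSubobject (q ≫ k)).Factors (pullback.fst q g) :=
            kernelSubobject_factors _ _ h2
          rw [← he] at h3
          exact (kernelSubobject_factors_iff _ _).1 h3
        rw [pullback.condition] at h1
        exact Preadditive.epi_iff_cancel_zero (pullback.snd q g) |>.1 inferInstance _ _ h1
      exact isIso_of_mono_of_epi k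
  exact key _ Y (𝟙 Y) inferInstance rfl

end Induction

section Retracts

variable {C : Type u} [Category.{v} C] [Abelian C]

theorem isSummand_iff {Z Y : C} :
    IsSummand Z Y ↔ ∃ (i : Z ⟶ Y) (p : Y ⟶ Z), i ≫ p = 𝟙 Z := by
  constructor
  · rintro ⟨W, ⟨e⟩⟩
    exact ⟨biprod.inl ≫ e.inv, e.hom ≫ biprod.fst, by simp⟩
  · rintro ⟨i, p, h⟩
    have : IsSplitMono i := ⟨⟨p, h⟩⟩
    let b := isBilimitBinaryBiconeOfIsSplitMonoOfCokernel (f := i) (cokernelIsCokernel i)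
    exact ⟨cokernel i, ⟨biprod.uniqueUpToIso _ _ b⟩⟩

theorem IsSummand.trans {W Z Y : C} (h₁ : IsSummand W Z) (h₂ : IsSummand Z Y) :
    IsSummand W Y := by
  rw [isSummand_iff] at *
  obtain ⟨i, p, h⟩ := h₁
  obtain ⟨j, q, k⟩ := h₂
  exact ⟨i ≫ j, q ≫ p, by simp [reassoc_of% k, h]⟩

theorem IsSummand.of_iso {Z Y : C} (e : Z ≅ Y) : IsSummand Z Y :=
  isSummand_iff.2 ⟨e.hom, e.inv, by simp⟩

theorem _root_.CategoryTheory.Indecomposable.isIso_of_retract {W Y : C} (hY : Indecomposable Y) (hW : ¬ IsZero W)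
    {i : W ⟶ Y} {p : Y ⟶ W} (h : i ≫ p = 𝟙 W) : IsIso i := by
  have : IsSplitMono i := ⟨⟨p, h⟩⟩
  let b := isBilimitBinaryBiconeOfIsSplitMonoOfCokernel (f := i) (cokernelIsCokernel i)
  have hz := (hY.2 W (cokernel i) (biprod.uniqueUpToIso _ _ b)).resolve_left hW
  have : Epi i := Preadditive.epi_of_cokernel_zero (hz.eq_of_tgt _ _)
  exact isIso_of_mono_of_epi i

theorem _root_.CategoryTheory.Indecomposable.of_iso {W Y : C} (hY : Indecomposable Y) (e : W ≅ Y) :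
    Indecomposable W :=
  ⟨fun h => hY.1 (h.of_iso e.symm), fun A B f => hY.2 A B (e.symm ≪≫ f)⟩

/-- A presentation of `Y` as a finite direct sum of indecomposable objects. -/
structure IndecDecomposition (Y : C) where
  J : Type
  fintype : Fintype J
  obj : J → C
  ι : ∀ j, obj j ⟶ Y
  π : ∀ j, Y ⟶ obj j
  indec : ∀ j, Indecomposable (obj j)
  retract : ∀ j, ι j ≫ π j = 𝟙 (obj j)
  total : ∑ j, π j ≫ ι j = 𝟙 Y

attribute [instance] IndecDecomposition.fintype

theorem IndecDecomposition.isSummand {Y : C} (d : IndecDecomposition Y) (j : d.J) :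
    IsSummand (d.obj j) Y :=
  isSummand_iff.2 ⟨d.ι j, d.π j, d.retract j⟩

variable [IsLengthCategory C]

theorem exists_indecDecomposition (Y : C) : Nonempty (IndecDecomposition Y) := by
  induction Y using subobject_induction with
  | h Y ih =>
    by_cases hz : IsZero Y
    · exact ⟨⟨Empty, inferInstance, Empty.elim, fun j => j.elim, fun j => j.elim,
        fun j => j.elim, fun j => j.elim, hz.eq_of_src _ _⟩⟩
    by_cases hi : Indecomposable Y
    · exact ⟨⟨Unit, inferInstance, fun _ => Y, fun _ => 𝟙 Y, fun _ => 𝟙 Y, fun _ => hi,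
        fun _ => by simp, by simp⟩⟩
    have : ∃ A B : C, ∃ _ : Y ≅ A ⊞ B, ¬ IsZero A ∧ ¬ IsZero B := by
      by_contra! hcon
      exact hi ⟨hz, fun A B e => or_iff_not_imp_left.2 (hcon A B e)⟩
    obtain ⟨A, B, e, hA, hB⟩ := this
    obtain ⟨dA⟩ := ih A (biprod.inl ≫ e.inv) inferInstance fun h => hB <| by
      have h1 : IsIso (biprod.inl : A ⟶ A ⊞ B) := by
        have : (biprod.inl : A ⟶ A ⊞ B) = (biprod.inl ≫ e.inv) ≫ e.hom := by simp
        rw [this]; infer_instance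
      exact (Biprod.isIso_inl_iff_isZero A B).1 h1
    obtain ⟨dB⟩ := ih B (biprod.inr ≫ e.inv) inferInstance fun h => hA <| by
      have h1 : IsIso (biprod.inr : B ⟶ A ⊞ B) := by
        have : (biprod.inr : B ⟶ A ⊞ B) = (biprod.inr ≫ e.inv) ≫ e.hom := by simp
        rw [this]; infer_instance
      have h2 : (biprod.fst : A ⊞ B ⟶ A) = 0 := by
        rw [← cancel_epi (biprod.inr : B ⟶ A ⊞ B)]; simp
      rw [IsZero.iff_id_eq_zero, ← biprod.inl_fst (X := A) (Y := B), h2, comp_zero]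
    refine ⟨⟨dA.J ⊕ dB.J, inferInstance, Sum.elim dA.obj dB.obj,
      Sum.rec (fun j => dA.ι j ≫ biprod.inl ≫ e.inv) (fun j => dB.ι j ≫ biprod.inr ≫ e.inv),
      Sum.rec (fun j => e.hom ≫ biprod.fst ≫ dA.π j) (fun j => e.hom ≫ biprod.snd ≫ dB.π j),
      Sum.rec dA.indec dB.indec, ?_, ?_⟩⟩
    · rintro (j | j)
      · simp [dA.retract]
      · simp [dB.retract]
    · rw [Fintype.sum_sum_type]
      have hA : ∑ j, (e.hom ≫ biprod.fst ≫ dA.π j) ≫ dA.ι j ≫ biprod.inl ≫ e.inv =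
          e.hom ≫ biprod.fst ≫ (∑ j, dA.π j ≫ dA.ι j) ≫ biprod.inl ≫ e.inv := by
        simp only [Preadditive.sum_comp, Preadditive.comp_sum, Category.assoc]
      have hB : ∑ j, (e.hom ≫ biprod.snd ≫ dB.π j) ≫ dB.ι j ≫ biprod.inr ≫ e.inv =
          e.hom ≫ biprod.snd ≫ (∑ j, dB.π j ≫ dB.ι j) ≫ biprod.inr ≫ e.inv := by
        simp only [Preadditive.sum_comp, Preadditive.comp_sum, Category.assoc]
      refine (congrArg₂ (· + ·) hA hB).trans ?_
      rw [dA.total, dB.total, Category.id_comp, Category.id_comp]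
      rw [← Preadditive.comp_add]
      have : biprod.fst ≫ biprod.inl ≫ e.inv + biprod.snd ≫ biprod.inr ≫ e.inv = e.inv := by
        rw [← Category.assoc, ← Category.assoc, ← Preadditive.add_comp, biprod.total,
          Category.id_comp]
      rw [this, e.hom_inv_id]

theorem exists_indec_summand {Y : C} (h : ¬ IsZero Y) :
    ∃ W : C, Indecomposable W ∧ IsSummand W Y := by
  obtain ⟨d⟩ := exists_indecDecomposition Y
  have : Nonempty d.J := by
    by_contra hJ
    rw [not_nonempty_iff] at hJ
    exact h ((IsZero.iff_id_eq_zero Y).2 (by rw [← d.total]; simp))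
  obtain ⟨j⟩ := this
  exact ⟨_, d.indec j, d.isSummand j⟩

end Retracts

section Fitting

variable {C : Type u} [Category.{v} C] [Abelian C]

theorem exists_epi_mono_fac {A B : C} (f : A ⟶ B) :
    ∃ (I : C) (e : A ⟶ I) (i : I ⟶ B), Epi e ∧ Mono i ∧ e ≫ i = f :=
  ⟨image f, factorThruImage f, image.ι f, inferInstance, inferInstance, image.fac f⟩

theorem kernelSubobject_pow_mono {Y : C} (f : End Y) :
    Monotone fun n : ℕ => kernelSubobject (X := Y) (Y := Y) (f ^ n) := by
  refine monotone_nat_of_le_succ fun n => ?_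
  rw [pow_succ']
  exact kernelSubobject_comp_le (X := Y) (Y := Y) (Z := Y) (f ^ n) f

variable [IsLengthCategory C]

/-- Fitting's lemma. -/
theorem _root_.CategoryTheory.Indecomposable.isIso_or_isNilpotent (lam : LengthFunction C) {Y : C}
    (hY : Indecomposable Y) (f : End Y) : IsUnit f ∨ IsNilpotent f := by
  have := IsLengthCategory.noetherian Y
  obtain ⟨n, hn⟩ := monotone_chain_condition_of_isNoetherianObject
    (⟨_, kernelSubobject_pow_mono f⟩ : ℕ →o Subobject Y)
  have hker : kernelSubobject (X := Y) (Y := Y) (f ^ (n + 1 + (n + 1))) =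
    kernelSubobject (X := Y) (Y := Y) (f ^ (n + 1)) :=
    (hn (n + 1 + (n + 1)) (by lia)).symm.trans (hn (n + 1) (by lia))
  let F : Y ⟶ Y := f ^ (n + 1)
  have hFF : F ≫ F = (f ^ (n + 1 + (n + 1)) : End Y) := by rw [pow_add f (n + 1)]; rfl
  have hk : ∀ {A : C} (g : A ⟶ Y), g ≫ F ≫ F = 0 → g ≫ F = 0 := by
    intro A g hg
    rw [hFF] at hg
    have h3 := kernelSubobject_factors _ _ hg
    rw [hker] at h3
    exact (kernelSubobject_factors_iff _ _).1 h3
  obtain ⟨I, e, i, he, hi, hei⟩ := exists_epi_mono_fac F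
  have hm : Mono (i ≫ e) := by
    refine Preadditive.mono_of_cancel_zero _ fun {A} g hg => ?_
    have h1 : pullback.fst e g ≫ F ≫ F = 0 := by
      have : F ≫ F = e ≫ (i ≫ e) ≫ i := by simp only [← hei, Category.assoc]
      rw [this, pullback.condition_assoc, ← Category.assoc g, hg, zero_comp, comp_zero]
    have h2 := hk _ h1
    rw [← hei, pullback.condition_assoc, ← Category.assoc] at h2
    have h3 : pullback.snd e g ≫ g = 0 := by
      rw [← cancel_mono i, zero_comp]; exact h2
    exact Preadditive.epi_iff_cancel_zero (pullback.snd e g) |>.1 inferInstance _ _ h3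
  have hiso : IsIso (i ≫ e) := lam.isIso_of_mono _ le_rfl
  by_cases hz : IsZero I
  · right
    refine ⟨n + 1, ?_⟩
    change F = 0
    rw [← hei, hz.eq_of_tgt e 0, zero_comp]
  · left
    have h1 : i ≫ (e ≫ inv (i ≫ e)) = 𝟙 _ := by
      rw [← Category.assoc]; exact IsIso.hom_inv_id _
    have hi : IsIso i := hY.isIso_of_retract hz h1
    have he : IsIso e := by
      have : e = inv i ≫ (i ≫ e) := by simp
      rw [this]; infer_instance
    have hF : IsIso F := by rw [← hei]; infer_instance
    exact (isUnit_pow_iff n.succ_ne_zero).1 ((isUnit_iff_isIso (f ^ (n + 1))).2 hF)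

theorem _root_.CategoryTheory.Indecomposable.isIso_or_isIso_of_add (lam : LengthFunction C) {Y Z : C}
    (hY : Indecomposable Y) (f g : Y ⟶ Z) (h : IsIso (f + g)) : IsIso f ∨ IsIso g := by
  let a : End Y := f ≫ inv (f + g)
  let b : End Y := g ≫ inv (f + g)
  have hab : a + b = 1 := by
    change f ≫ inv (f + g) + g ≫ inv (f + g) = 𝟙 Y
    rw [← Preadditive.add_comp, IsIso.hom_inv_id]
  have of_unit : ∀ k : Y ⟶ Z, IsUnit (M := End Y) (k ≫ inv (f + g)) → IsIso k := by
    intro k hk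
    have h1 : IsIso (k ≫ inv (f + g)) := (isUnit_iff_isIso _).1 hk
    have : k = (k ≫ inv (f + g)) ≫ (f + g) := by
      rw [Category.assoc, IsIso.inv_hom_id, Category.comp_id]
    rw [this]; infer_instance
  rcases hY.isIso_or_isNilpotent lam a with ha | ha
  · exact Or.inl (of_unit f ha)
  · right
    refine of_unit g ?_
    have : b = 1 - a := by rw [← hab]; abel
    change IsUnit b
    rw [this]
    exact ha.isUnit_one_sub

theorem _root_.CategoryTheory.Indecomposable.exists_isIso_of_sum (lam : LengthFunction C) {Y Z : C}
    (hY : Indecomposable Y) {J : Type*} (s : Finset J) (f : J → (Y ⟶ Z))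
    (h : IsIso (∑ j ∈ s, f j)) : ∃ j ∈ s, IsIso (f j) := by
  classical
  induction s using Finset.induction_on with
  | empty =>
    exfalso
    simp only [Finset.sum_empty] at h
    refine hY.1 ((IsZero.iff_id_eq_zero Y).2 ?_)
    rw [← IsIso.hom_inv_id (0 : Y ⟶ Z), zero_comp]
  | insert a s ha ih =>
    rw [Finset.sum_insert ha] at h
    rcases hY.isIso_or_isIso_of_add lam _ _ h with h | h
    · exact ⟨a, by simp, h⟩
    · obtain ⟨j, hj, h⟩ := ih h
      exact ⟨j, by simp [hj], h⟩

/-- If an indecomposable `Y` is a retract of a finite family of objects jointly, then it is a retract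
of one of them. -/
theorem _root_.CategoryTheory.Indecomposable.exists_retract (lam : LengthFunction C) {Y : C}
    (hY : Indecomposable Y) {J : Type*} [Fintype J] {V : J → C} (a : ∀ j, Y ⟶ V j)
    (b : ∀ j, V j ⟶ Y) (h : ∑ j, a j ≫ b j = 𝟙 Y) : ∃ j, IsIso (a j ≫ b j) := by
  obtain ⟨j, -, hj⟩ := hY.exists_isIso_of_sum lam Finset.univ (fun j => a j ≫ b j)
    (by rw [h]; infer_instance)
  exact ⟨j, hj⟩

theorem _root_.CategoryTheory.Indecomposable.exists_isSummand_of_biproduct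
    (lam : LengthFunction C) {n : ℕ} {F : Fin n → C}
    {Y : C} (hY : Indecomposable Y) (h : IsSummand Y (⨁ F)) : ∃ j, IsSummand Y (F j) := by
  obtain ⟨i, p, h⟩ := isSummand_iff.1 h
  obtain ⟨j, hj⟩ := hY.exists_retract lam (fun j => i ≫ biproduct.π F j)
    (fun j => biproduct.ι F j ≫ p) (by
      have : ∑ j, (i ≫ biproduct.π F j) ≫ biproduct.ι F j ≫ p =
          i ≫ (∑ j, biproduct.π F j ≫ biproduct.ι F j) ≫ p := by
        simp only [Preadditive.sum_comp, Preadditive.comp_sum, Category.assoc]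
      rw [this, biproduct.total, Category.id_comp, h])
  refine ⟨j, isSummand_iff.2 ⟨i ≫ biproduct.π F j, (biproduct.ι F j ≫ p) ≫
    inv ((i ≫ biproduct.π F j) ≫ biproduct.ι F j ≫ p), ?_⟩⟩
  rw [← Category.assoc]
  exact IsIso.hom_inv_id _

end Fitting

namespace GRSet

theorem of_lt_of {I J : Finset ℝ≥0} :
    of I < of J ↔ ∃ a ∈ J, a ∉ I ∧ ∀ b ∈ I, b ∉ J → a < b := by
  unfold of
  rw [Finset.Colex.lt_iff_exists_forall_lt]
  constructor
  · rintro ⟨a, haJ, haI, ha⟩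
    obtain ⟨a, rfl⟩ := OrderDual.toDual.surjective a
    refine ⟨a, by simpa using haJ, by simpa using haI, fun b hb hb' => ?_⟩
    exact OrderDual.toDual_lt_toDual.1 (ha (OrderDual.toDual b) (by simpa using hb)
      (by simpa using hb'))
  · rintro ⟨a, haJ, haI, ha⟩
    refine ⟨OrderDual.toDual a, by simpa using haJ, by simpa using haI, fun b hb hb' => ?_⟩
    obtain ⟨b, rfl⟩ := OrderDual.toDual.surjective b
    exact OrderDual.toDual_lt_toDual.2 (ha b (by simpa using hb) (by simpa using hb'))

theorem of_injective : Function.Injective of := fun I J h => by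
  simpa [of] using h

theorem of_lt_of_ssubset {I J : Finset ℝ≥0} (h : I ⊂ J) : of I < of J := by
  obtain ⟨a, haJ, haI⟩ := Finset.exists_of_ssubset h
  exact of_lt_of.2 ⟨a, haJ, haI, fun b hb hb' => absurd (h.1 hb) hb'⟩

theorem of_insert_lt {I J : Finset ℝ≥0} {m : ℝ≥0} (hJ : ∀ x ∈ J, x < m) (h : of I < of J) :
    of (insert m I) < of J := by
  obtain ⟨a, haJ, haI, ha⟩ := of_lt_of.1 h
  refine of_lt_of.2 ⟨a, haJ, ?_, fun b hb hb' => ?_⟩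
  · rw [Finset.mem_insert, not_or]
    exact ⟨(hJ a haJ).ne, haI⟩
  · rcases Finset.mem_insert.1 hb with rfl | hb
    · exact hJ a haJ
    · exact ha b hb hb'

theorem isGreatest_max {S : Set GRSet} (hf : S.Finite) (hS : S.Nonempty) :
    IsGreatest S (GRSet.max S) := by
  have h : ∃ m, IsGreatest S m := by
    obtain ⟨m, hm, hmax⟩ := Set.exists_max_image S id hf hS
    exact ⟨m, hm, hmax⟩
  unfold GRSet.max
  rw [dif_pos h]
  exact h.choose_spec

end GRSet

section Values

variable {C : Type u} [Category.{v} C] [Abelian C] (lam : LengthFunction C)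

/-- The lengths of the subobjects of `Y`. -/
def subobjectLengths (Y : C) : Set ℝ≥0 :=
  {x | ∃ (W : C) (m : W ⟶ Y), Mono m ∧ lam.toFun W = x}

theorem subobjectLengths_subset {S Y Q : C} (i : S ⟶ Y) (q : Y ⟶ Q) [Mono i]
    (hk : ∀ {A : C} (g : A ⟶ Y), g ≫ q = 0 → ∃ g' : A ⟶ S, g' ≫ i = g) :
    subobjectLengths lam Y ⊆
      Set.image2 (· + ·) (subobjectLengths lam S) (subobjectLengths lam Q) := by
  rintro x ⟨W, m, hm, rfl⟩
  obtain ⟨I, e, j, he, hj, hej⟩ := exists_epi_mono_fac (m ≫ q)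
  obtain ⟨k, hk⟩ := hk (kernel.ι e ≫ m) (by
    rw [Category.assoc, ← hej, kernel.condition_assoc, zero_comp])
  have : Mono (k ≫ i) := by rw [hk]; infer_instance
  have : Mono k := mono_of_mono k i
  exact ⟨_, ⟨_, k, inferInstance, rfl⟩, _, ⟨_, j, hj, rfl⟩, (lam.eq_kernel_add e).symm⟩

theorem finite_subobjectLengths [IsLengthCategory C] (Y : C) :
    (subobjectLengths lam Y).Finite := by
  induction Y using quotient_induction with
  | h Y ih =>
    by_cases hz : IsZero Y
    · refine (Set.finite_singleton 0).subset ?_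
      rintro x ⟨W, m, hm, rfl⟩
      rw [Set.mem_singleton_iff, lam.eq_zero_iff, IsZero.iff_id_eq_zero, ← cancel_mono m]
      exact hz.eq_of_tgt _ _
    have := IsLengthCategory.artinian Y
    obtain ⟨S, hS⟩ := exists_simple_subobject hz
    have hnz : S.arrow ≠ 0 := fun h => Simple.not_isZero (S : C) <| by
      rw [IsZero.iff_id_eq_zero, ← cancel_mono S.arrow, h]; simp
    refine Set.Finite.subset (Set.Finite.image2 _ ?_ (ih _ (cokernel.π S.arrow) inferInstance ?_))
      (subobjectLengths_subset lam S.arrow (cokernel.π S.arrow) ?_)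
    · refine (Set.toFinite {0, lam.toFun (S : C)}).subset ?_
      rintro x ⟨W, m, hm, rfl⟩
      by_cases h0 : m = 0
      · left
        rw [lam.eq_zero_iff, IsZero.iff_id_eq_zero, ← cancel_mono m, h0]; simp
      · right
        have := isIso_of_mono_of_nonzero h0
        exact lam.eq_of_iso (asIso m)
    · intro h
      refine hnz ?_
      rw [← cancel_mono (cokernel.π S.arrow), cokernel.condition, zero_comp]
    · intro A g hg
      exact ⟨Abelian.monoLift S.arrow g hg, Abelian.monoLift_comp _ _ _⟩

end Values

section IndecMeasure

variable {C : Type u} [Category.{v} C] [Abelian C] (lam : LengthFunction C)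

open Classical in
theorem mem_lengthSet {Y : C} (c : Finset (Subobject Y)) :
    lengthSet lam c = GRSet.of (c.image fun Z : Subobject Y => lam.toFun (Z : C)) := rfl

/-- The sets of lengths of the finite chains of indecomposable subobjects of `Y`. -/
abbrev chainSets (Y : C) : Set GRSet :=
  {I | ∃ c : Finset (Subobject Y), c.Nonempty ∧
    IsChain (· ≤ ·) (c : Set (Subobject Y)) ∧
    (∀ Z ∈ c, Indecomposable (Z : C)) ∧ I = lengthSet lam c}

theorem chainSets_nonempty {Y : C} (hY : Indecomposable Y) : (chainSets lam Y).Nonempty :=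
  ⟨_, {⊤}, by simp, by simp, fun Z hZ => by
    rw [Finset.mem_singleton] at hZ
    subst hZ
    exact hY.of_iso (asIso (⊤ : Subobject Y).arrow), rfl⟩

theorem lam_subobject_lt {Y : C} {Z W : Subobject Y} (h : Z < W) :
    lam.toFun (Z : C) < lam.toFun (W : C) := by
  refine lt_of_not_ge fun hle => h.not_ge ?_
  have := lam.isIso_of_mono (Subobject.ofLE Z W h.le) hle
  exact Subobject.le_of_comm (inv (Subobject.ofLE Z W h.le)) (by simp)

theorem chainSets_mono {W Y : C} (m : W ⟶ Y) [Mono m] : chainSets lam W ⊆ chainSets lam Y := by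
  classical
  rintro I ⟨c, hc, hchain, hind, rfl⟩
  refine ⟨c.image fun Z => Subobject.mk (Z.arrow ≫ m), hc.image _, ?_, ?_, ?_⟩
  · rw [Finset.coe_image]
    rintro _ ⟨A, hA, rfl⟩ _ ⟨B, hB, rfl⟩ hne
    have h : ∀ {A B : Subobject W}, A ≤ B →
        Subobject.mk (A.arrow ≫ m) ≤ Subobject.mk (B.arrow ≫ m) := fun {A B} hAB =>
      Subobject.mk_le_mk_of_comm (Subobject.ofLE A B hAB) (by simp)
    exact (hchain.total hA hB).imp h h
  · intro Z hZ
    obtain ⟨A, hA, rfl⟩ := Finset.mem_image.1 hZ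
    exact (hind A hA).of_iso (Subobject.underlyingIso _)
  · rw [mem_lengthSet, mem_lengthSet, Finset.image_image]
    congr 1
    refine Finset.image_congr fun A _ => ?_
    exact (lam.eq_of_iso (Subobject.underlyingIso _)).symm

theorem lengthSet_mem_chainSets {Y : C} (c : Finset (Subobject Y)) (W : Subobject Y) (hW : W ∈ c)
    (hle : ∀ Z ∈ c, Z ≤ W) (hchain : IsChain (· ≤ ·) (c : Set (Subobject Y)))
    (hind : ∀ Z ∈ c, Indecomposable (Z : C)) : lengthSet lam c ∈ chainSets lam (W : C) := by
  classical
  refine ⟨c.attach.image fun Z => Subobject.mk (Subobject.ofLE Z.1 W (hle _ Z.2)),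
    Finset.Nonempty.image ⟨⟨W, hW⟩, by simp⟩ _, ?_, ?_, ?_⟩
  · rw [Finset.coe_image]
    rintro _ ⟨A, hA, rfl⟩ _ ⟨B, hB, rfl⟩ hne
    refine (hchain.total A.2 B.2).imp (fun h => ?_) (fun h => ?_)
    · exact Subobject.mk_le_mk_of_comm (Subobject.ofLE A.1 B.1 h) (by simp)
    · exact Subobject.mk_le_mk_of_comm (Subobject.ofLE B.1 A.1 h) (by simp)
  · intro Z hZ
    obtain ⟨A, hA, rfl⟩ := Finset.mem_image.1 hZ
    exact (hind A.1 A.2).of_iso (Subobject.underlyingIso _)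
  · rw [mem_lengthSet, mem_lengthSet, Finset.image_image]
    congr 1
    conv_lhs => rw [← Finset.attach_image_val (s := c), Finset.image_image]
    refine Finset.image_congr fun A _ => ?_
    exact (lam.eq_of_iso (Subobject.underlyingIso _)).symm

variable [IsLengthCategory C]

theorem finite_chainSets (Y : C) : (chainSets lam Y).Finite := by
  classical
  refine ((finite_subobjectLengths lam Y).toFinset.powerset.image GRSet.of).finite_toSet.subset ?_
  rintro I ⟨c, -, -, -, rfl⟩
  rw [Finset.mem_coe, mem_lengthSet]
  refine Finset.mem_image_of_mem _ (Finset.mem_powerset.2 fun x hx => ?_)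
  obtain ⟨Z, -, rfl⟩ := Finset.mem_image.1 hx
  exact (Set.Finite.mem_toFinset _).2 ⟨_, Z.arrow, inferInstance, rfl⟩

theorem isGreatest_indecMeasure {Y : C} (hY : Indecomposable Y) :
    IsGreatest (chainSets lam Y) (indecMeasure lam Y) :=
  GRSet.isGreatest_max (finite_chainSets lam Y) (chainSets_nonempty lam hY)

theorem indecMeasure_le_of_mono {W Y : C} (hW : Indecomposable W) (hY : Indecomposable Y)
    (m : W ⟶ Y) [Mono m] : indecMeasure lam W ≤ indecMeasure lam Y :=
  (isGreatest_indecMeasure lam hY).2 (chainSets_mono lam m (isGreatest_indecMeasure lam hW).1)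

theorem indecMeasure_eq_of_iso {W Y : C} (hY : Indecomposable Y) (e : W ≅ Y) :
    indecMeasure lam W = indecMeasure lam Y :=
  le_antisymm (indecMeasure_le_of_mono lam (hY.of_iso e) hY e.hom)
    (indecMeasure_le_of_mono lam hY (hY.of_iso e) e.inv)

theorem exists_chain_indecMeasure {Y : C} (hY : Indecomposable Y) :
    ∃ c : Finset (Subobject Y), ⊤ ∈ c ∧ IsChain (· ≤ ·) (c : Set (Subobject Y)) ∧
      (∀ Z ∈ c, Indecomposable (Z : C)) ∧ indecMeasure lam Y = lengthSet lam c := by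
  classical
  obtain ⟨c, hne, hchain, hind, hc⟩ := (isGreatest_indecMeasure lam hY).1
  refine ⟨c, ?_, hchain, hind, hc⟩
  by_contra htop
  have hmem : lengthSet lam (insert ⊤ c) ∈ chainSets lam Y := by
    refine ⟨insert ⊤ c, by simp, ?_, ?_, rfl⟩
    · rw [Finset.coe_insert]
      exact hchain.insert fun b _ _ => Or.inr le_top
    · intro Z hZ
      rcases Finset.mem_insert.1 hZ with rfl | hZ
      · exact hY.of_iso (asIso (⊤ : Subobject Y).arrow)
      · exact hind Z hZ
  refine ((isGreatest_indecMeasure lam hY).2 hmem).not_gt ?_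
  rw [hc, mem_lengthSet, mem_lengthSet, Finset.image_insert]
  refine GRSet.of_lt_of_ssubset (Finset.ssubset_insert fun hmem => ?_)
  obtain ⟨Z, hZ, hZe⟩ := Finset.mem_image.1 hmem
  exact (lam_subobject_lt lam (lt_top_iff_ne_top.2 fun h => htop (h ▸ hZ))).ne hZe

theorem indecMeasure_eq_of {Y : C} (hY : Indecomposable Y) :
    ∃ I : Finset ℝ≥0, indecMeasure lam Y = GRSet.of I ∧ lam.toFun Y ∈ I ∧
      ∀ x ∈ I, x ≤ lam.toFun Y := by
  classical
  obtain ⟨c, htop, -, -, hc⟩ := exists_chain_indecMeasure lam hY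
  refine ⟨_, hc, Finset.mem_image.2 ⟨⊤, htop, ?_⟩, fun x hx => ?_⟩
  · exact lam.eq_of_iso (asIso (⊤ : Subobject Y).arrow)
  · obtain ⟨Z, -, rfl⟩ := Finset.mem_image.1 hx
    exact lam.le_of_mono Z.arrow

theorem lam_eq_of_indecMeasure_eq {Y Z : C} (hY : Indecomposable Y) (hZ : Indecomposable Z)
    (h : indecMeasure lam Y = indecMeasure lam Z) : lam.toFun Y = lam.toFun Z := by
  obtain ⟨I, hI, hYI, hI'⟩ := indecMeasure_eq_of lam hY
  obtain ⟨J, hJ, hZJ, hJ'⟩ := indecMeasure_eq_of lam hZ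
  obtain rfl : I = J := GRSet.of_injective (by rw [← hI, ← hJ, h])
  exact le_antisymm (hJ' _ hYI) (hI' _ hZJ)

/-- The main property of the Gabriel-Roiter measure. -/
theorem exists_indecMeasure_lt_or_isIso (X : C) : Indecomposable X →
    ∀ (J : Type) [Fintype J] (Y : J → C) (_ : ∀ j, Indecomposable (Y j)) (f : ∀ j, X ⟶ Y j),
      (∀ (A : C) (g : A ⟶ X), (∀ j, g ≫ f j = 0) → g = 0) →
      ∃ j, indecMeasure lam X < indecMeasure lam (Y j) ∨ IsIso (f j) := by
  classical
  induction X using subobject_induction with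
  | h X ih =>
    intro hX J _ Y hY f hf
    by_contra! hcon
    choose I e i he hi hei using fun j => exists_epi_mono_fac (f j)
    have d := fun j => (exists_indecDecomposition (I j)).some
    let K := Σ j, (d j).J
    let W : K → C := fun k => (d k.1).obj k.2
    let g : ∀ k, X ⟶ W k := fun k => e k.1 ≫ (d k.1).π k.2
    have hW : ∀ k, Indecomposable (W k) := fun k => (d k.1).indec k.2
    have hsplit : ∀ k : K, IsSplitEpi ((d k.1).π k.2) := fun k => ⟨⟨_, (d k.1).retract k.2⟩⟩
    have hsplit' : ∀ k : K, IsSplitMono ((d k.1).ι k.2) := fun k => ⟨⟨_, (d k.1).retract k.2⟩⟩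
    have hg : ∀ k, Epi (g k) := fun k => by dsimp only [g]; infer_instance
    have hWY : ∀ k : K, indecMeasure lam (W k) ≤ indecMeasure lam (Y k.1) := fun k =>
      indecMeasure_le_of_mono lam (hW k) (hY k.1) ((d k.1).ι k.2 ≫ i k.1)
    have hjoint : ∀ (A : C) (a : A ⟶ X), (∀ k, a ≫ g k = 0) → a = 0 := by
      intro A a ha
      refine hf A a fun j => ?_
      have : a ≫ e j = 0 := by
        rw [← Category.comp_id (a ≫ e j), ← (d j).total, Preadditive.comp_sum]
        refine Finset.sum_eq_zero fun k _ => ?_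
        have := ha ⟨j, k⟩
        dsimp only [g] at this
        rw [← Category.assoc, Category.assoc a, this, zero_comp]
      rw [← hei, reassoc_of% this, zero_comp]
    have hlam : ∀ k, lam.toFun (W k) < lam.toFun X := by
      intro k
      refine lt_of_not_ge fun hle => ?_
      have h1 : IsIso (g k) := lam.isIso_of_epi _ hle
      have h2 : Mono (e k.1 ≫ (d k.1).π k.2) := by change Mono (g k); infer_instance
      have h3 : Mono (e k.1) := mono_of_mono _ ((d k.1).π k.2)
      have h4 : Mono (f k.1) := by rw [← hei]; infer_instance
      have h5 := le_antisymm (indecMeasure_le_of_mono lam hX (hY k.1) (f k.1)) (hcon k.1).1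
      exact (hcon k.1).2
        (lam.isIso_of_mono _ (lam_eq_of_indecMeasure_eq lam hX (hY k.1) h5).ge)
    have hlt : ∀ k, indecMeasure lam (W k) < indecMeasure lam X := fun k =>
      lt_of_le_of_ne ((hWY k).trans (hcon k.1).1) fun h =>
        (hlam k).ne (lam_eq_of_indecMeasure_eq lam (hW k) hX h)
    obtain ⟨k₀⟩ : Nonempty K := by
      by_contra hK
      rw [not_nonempty_iff] at hK
      exact hX.1 ((IsZero.iff_id_eq_zero X).2 (hjoint X (𝟙 X) fun k => (hK.false k).elim))
    obtain ⟨c, htop, hchain, hind, hc⟩ := exists_chain_indecMeasure lam hX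
    have hc' : indecMeasure lam X = GRSet.of (insert (lam.toFun X)
        ((c.erase ⊤).image fun Z : Subobject X => lam.toFun (Z : C))) := by
      rw [hc, mem_lengthSet]
      conv_lhs => rw [← Finset.insert_erase htop, Finset.image_insert]
      rw [lam.eq_of_iso (asIso (⊤ : Subobject X).arrow)]
    have hfin : ∀ k, ¬ lengthSet lam (c.erase ⊤) < indecMeasure lam (W k) := by
      intro k hk
      obtain ⟨I, hI, -, hI'⟩ := indecMeasure_eq_of lam (hW k)
      refine (hlt k).not_gt ?_
      rw [hc', hI]
      exact GRSet.of_insert_lt (fun x hx => (hI' x hx).trans_lt (hlam k)) (hI ▸ hk)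
    rcases (c.erase ⊤).eq_empty_or_nonempty with hemp | hne
    · refine hfin k₀ ?_
      obtain ⟨I, hI, hmem, -⟩ := indecMeasure_eq_of lam (hW k₀)
      rw [hemp, hI, mem_lengthSet, Finset.image_empty]
      exact GRSet.of_lt_of_ssubset (Finset.empty_ssubset.2 ⟨_, hmem⟩)
    · obtain ⟨X', hX', hmax⟩ := (c.erase ⊤).exists_maximal hne
      have hchain' : IsChain (· ≤ ·) ((c.erase ⊤ : Finset _) : Set (Subobject X)) :=
        hchain.mono (Finset.coe_subset.2 (Finset.erase_subset _ _))
      have hle : ∀ Z ∈ c.erase ⊤, Z ≤ X' := fun Z hZ =>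
        (hchain'.total hZ hX').elim id fun h => hmax hZ h
      have hind' : ∀ Z ∈ c.erase ⊤, Indecomposable (Z : C) := fun Z hZ =>
        hind Z (Finset.mem_of_mem_erase hZ)
      have hniso : ¬ IsIso X'.arrow := fun h =>
        Finset.ne_of_mem_erase hX' ((Subobject.isIso_arrow_iff_eq_top X').1 h)
      obtain ⟨k, hk | hk⟩ := ih (X' : C) X'.arrow inferInstance hniso (hind' X' hX') K W hW
        (fun k => X'.arrow ≫ g k) fun A a ha => by
          have := hjoint A (a ≫ X'.arrow) fun k => by rw [Category.assoc]; exact ha k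
          rw [← cancel_mono X'.arrow, this, zero_comp]
      · exact hfin k (lt_of_le_of_lt ((isGreatest_indecMeasure lam (hind' X' hX')).2
          (lengthSet_mem_chainSets lam _ X' hX' hle hchain' hind')) hk)
      · refine hniso (hX.isIso_of_retract (hind' X' hX').1
          (p := g k ≫ inv (X'.arrow ≫ g k)) ?_)
        rw [← Category.assoc]
        exact IsIso.hom_inv_id _

end IndecMeasure

section GRMeasure

variable {C : Type u} [Category.{v} C] [Abelian C] [IsLengthCategory C] (lam : LengthFunction C)

theorem isGreatest_grMeasure {X : C} (hX : ¬ IsZero X) :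
    IsGreatest {I | ∃ Y : C, Indecomposable Y ∧ IsSummand Y X ∧ I = indecMeasure lam Y}
      (grMeasure lam X) := by
  refine GRSet.isGreatest_max ((finite_chainSets lam X).subset ?_) ?_
  · rintro _ ⟨Y, hY, hYX, rfl⟩
    obtain ⟨i, p, h⟩ := isSummand_iff.1 hYX
    have : IsSplitMono i := ⟨⟨p, h⟩⟩
    exact chainSets_mono lam i (isGreatest_indecMeasure lam hY).1
  · obtain ⟨Y, hY, hYX⟩ := exists_indec_summand hX
    exact ⟨_, Y, hY, hYX, rfl⟩

omit [IsLengthCategory C] in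
theorem IsSummand.not_isZero {Y X : C} (h : IsSummand Y X) (hY : ¬ IsZero Y) : ¬ IsZero X := by
  obtain ⟨i, p, h⟩ := isSummand_iff.1 h
  intro hX
  exact hY ((IsZero.iff_id_eq_zero Y).2 (by rw [← h, hX.eq_of_tgt i 0, zero_comp]))

theorem indecMeasure_le_grMeasure {Y X : C} (hY : Indecomposable Y) (h : IsSummand Y X) :
    indecMeasure lam Y ≤ grMeasure lam X :=
  (isGreatest_grMeasure lam (h.not_isZero hY.1)).2 ⟨Y, hY, h, rfl⟩

theorem exists_indecMeasure_eq_grMeasure {X : C} (hX : ¬ IsZero X) :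
    ∃ Y : C, Indecomposable Y ∧ IsSummand Y X ∧ indecMeasure lam Y = grMeasure lam X := by
  obtain ⟨Y, hY, h, he⟩ := (isGreatest_grMeasure lam hX).1
  exact ⟨Y, hY, h, he.symm⟩

theorem grMeasure_eq_indecMeasure {Y : C} (hY : Indecomposable Y) :
    grMeasure lam Y = indecMeasure lam Y := by
  obtain ⟨W, hW, h, he⟩ := exists_indecMeasure_eq_grMeasure lam hY.1
  obtain ⟨i, p, h⟩ := isSummand_iff.1 h
  have := hY.isIso_of_retract hW.1 h
  rw [← he]
  exact indecMeasure_eq_of_iso lam hY (asIso i)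

/-- `V` embeds into a finite direct sum of indecomposable objects of measure smaller than `I`. -/
def CogeneratedLT (I : GRSet) (V : C) : Prop :=
  ∃ (J : Type) (_ : Fintype J) (T : J → C) (f : ∀ j, V ⟶ T j), (∀ j, indecLT lam I (T j)) ∧
    ∀ (A : C) (g : A ⟶ V), (∀ j, g ≫ f j = 0) → g = 0

variable {lam} in
theorem CogeneratedLT.indecMeasure_lt {I : GRSet} {V W : C} (hV : CogeneratedLT lam I V)
    (hW : Indecomposable W) (m : W ⟶ V) [Mono m] : indecMeasure lam W < I := by
  obtain ⟨J, _, T, f, hT, hf⟩ := hV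
  obtain ⟨j, hj⟩ := exists_indecMeasure_lt_or_isIso lam W hW J T (fun j => (hT j).1)
    (fun j => m ≫ f j) fun A g hg => by
      have := hf A (g ≫ m) fun j => by rw [Category.assoc]; exact hg j
      rw [← cancel_mono m, this, zero_comp]
  refine lt_of_le_of_lt ?_ (grMeasure_eq_indecMeasure lam (hT j).1 ▸ (hT j).2)
  rcases hj with hj | hj
  · exact hj.le
  · exact (indecMeasure_eq_of_iso lam (hT j).1 (asIso (m ≫ f j))).le

variable {lam} in
theorem CogeneratedLT.of_summands {I : GRSet} {V : C}
    (h : ∀ W : C, Indecomposable W → IsSummand W V → indecMeasure lam W < I) :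
    CogeneratedLT lam I V := by
  obtain ⟨d⟩ := exists_indecDecomposition V
  refine ⟨d.J, inferInstance, d.obj, d.π, fun j => ⟨d.indec j, ?_⟩, fun A g hg => ?_⟩
  · rw [grMeasure_eq_indecMeasure lam (d.indec j)]
    exact h _ (d.indec j) (d.isSummand j)
  · rw [← Category.comp_id g, ← d.total, Preadditive.comp_sum]
    exact Finset.sum_eq_zero fun j _ => by rw [← Category.assoc, hg, zero_comp]

/-- The quotient of `X` by the reject of the indecomposable objects of measure smaller
than `I`. -/
noncomputable def rejectQuotient (I : GRSet) (X : C) : C :=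
  cokernel (reject (indecLT lam I) X).arrow

/-- The projection onto the quotient by the reject. -/
noncomputable def rejectProj (I : GRSet) (X : C) : X ⟶ rejectQuotient lam I X :=
  cokernel.π (reject (indecLT lam I) X).arrow

instance (I : GRSet) (X : C) : Epi (rejectProj lam I X) :=
  inferInstanceAs (Epi (cokernel.π _))

theorem exists_factor_of_reject_comp_eq_zero {I : GRSet} {X T : C} (f : X ⟶ T)
    (hf : (reject (indecLT lam I) X).arrow ≫ f = 0) : ∃ g, rejectProj lam I X ≫ g = f :=
  ⟨cokernel.desc _ f hf, cokernel.π_desc _ _ _⟩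

theorem exists_factor_rejectProj {I : GRSet} {X V : C} (hV : CogeneratedLT lam I V)
    (f : X ⟶ V) : ∃ g, rejectProj lam I X ≫ g = f := by
  obtain ⟨J, _, T, t, hT, ht⟩ := hV
  refine exists_factor_of_reject_comp_eq_zero lam f (ht _ _ fun j => ?_)
  have hle := (isGLB_reject (indecLT lam I) X).1 ⟨T j, hT j, f ≫ t j, rfl⟩
  rw [Category.assoc, ← Subobject.ofLE_arrow hle, Category.assoc, kernelSubobject_arrow_comp,
    comp_zero]

omit [IsLengthCategory C] in
theorem exists_finset_inf_le {X : C} [IsArtinianObject X] (S : Set (Subobject X)) :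
    ∃ F : Finset (Subobject X), (F : Set (Subobject X)) ⊆ S ∧ ∀ K ∈ S, F.inf id ≤ K := by
  classical
  let T : Set (Subobject X) := Set.range fun F : {F : Finset (Subobject X) // ↑F ⊆ S} => F.1.inf id
  obtain ⟨m, ⟨⟨F, hF⟩, rfl⟩, hmin⟩ := WellFounded.has_min
    (wellFounded_lt (α := Subobject X)) T ⟨_, ⟨⟨∅, by simp⟩, rfl⟩⟩
  refine ⟨F, hF, fun a ha => ?_⟩
  have h := hmin ((insert a F).inf id)
    ⟨⟨insert a F, by rw [Finset.coe_insert]; exact Set.insert_subset ha hF⟩, rfl⟩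
  rw [Finset.inf_insert, id] at h
  by_contra hle
  exact h (lt_of_le_of_ne inf_le_right fun he => hle (inf_eq_right.1 he))

theorem cogeneratedLT_rejectQuotient (I : GRSet) (X : C) :
    CogeneratedLT lam I (rejectQuotient lam I X) := by
  have := IsLengthCategory.artinian X
  obtain ⟨F, hF, hinf⟩ := exists_finset_inf_le (kernelsInto (indecLT lam I) X)
  have hle : F.inf id ≤ reject (indecLT lam I) X := (isGLB_reject (indecLT lam I) X).2 hinf
  choose T hT f hf using fun k : Fin F.card => hF (F.equivFin.symm k).2
  have hfz : ∀ k, (reject (indecLT lam I) X).arrow ≫ f k = 0 := fun k => by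
    have hle := (isGLB_reject (indecLT lam I) X).1 ⟨T k, hT k, f k, rfl⟩
    rw [← Subobject.ofLE_arrow hle, Category.assoc, kernelSubobject_arrow_comp, comp_zero]
  choose t ht using fun k => exists_factor_of_reject_comp_eq_zero lam (f k) (hfz k)
  refine ⟨Fin F.card, inferInstance, T, t, hT, ?_⟩
  intro A g hg
  have h1 : ∀ k, pullback.fst (rejectProj lam I X) g ≫ f k = 0 := fun k => by
    rw [← ht, pullback.condition_assoc, hg, comp_zero]
  have h2 : (F.inf id).Factors (pullback.fst (rejectProj lam I X) g) := by
    refine (Subobject.finset_inf_factors _).2 fun K hK => ?_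
    have h3 := hf (F.equivFin ⟨K, hK⟩)
    simp only [Equiv.symm_apply_apply] at h3
    rw [id, h3]
    exact kernelSubobject_factors _ _ (h1 _)
  have h3 : pullback.fst (rejectProj lam I X) g ≫ rejectProj lam I X = 0 := by
    rw [← Subobject.factorThru_arrow _ _ (Subobject.factors_of_le _ hle h2), Category.assoc]
    exact (congrArg _ (cokernel.condition _)).trans comp_zero
  rw [pullback.condition] at h3
  exact Preadditive.epi_iff_cancel_zero (pullback.snd (rejectProj lam I X) g) |>.1
    inferInstance _ _ h3

theorem IsSummand.rejectQuotient {Y X : C} (h : IsSummand Y X) (I : GRSet) :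
    IsSummand (rejectQuotient lam I Y) (rejectQuotient lam I X) := by
  obtain ⟨i, p, h⟩ := isSummand_iff.1 h
  obtain ⟨i', hi⟩ := exists_factor_rejectProj lam (cogeneratedLT_rejectQuotient lam I X)
    (i ≫ rejectProj lam I X)
  obtain ⟨p', hp⟩ := exists_factor_rejectProj lam (cogeneratedLT_rejectQuotient lam I Y)
    (p ≫ rejectProj lam I Y)
  refine isSummand_iff.2 ⟨i', p', ?_⟩
  rw [← cancel_epi (rejectProj lam I Y), ← Category.assoc, hi, Category.assoc, hp,
    ← Category.assoc, h, Category.id_comp, Category.comp_id]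

/-- A morphism between indecomposable objects that does not increase the measure and is not
invertible factors through the quotient by the reject. -/
theorem exists_factor_of_not_isIso {Y Z : C} (hY : Indecomposable Y) (hZ : Indecomposable Z)
    (hle : indecMeasure lam Z ≤ indecMeasure lam Y) (f : Y ⟶ Z) (hf : ¬ IsIso f) :
    ∃ g, rejectProj lam (indecMeasure lam Y) Y ≫ g = f := by
  obtain ⟨I, e, i, he, hi, hei⟩ := exists_epi_mono_fac f
  obtain ⟨g, hg⟩ := exists_factor_rejectProj lam (I := indecMeasure lam Y) (V := I)
    (CogeneratedLT.of_summands fun W hW hWI => by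
      by_contra! hcon
      obtain ⟨j, p, h⟩ := isSummand_iff.1 hWI
      have : IsSplitMono j := ⟨⟨p, h⟩⟩
      have h1 := indecMeasure_le_of_mono lam hW hZ (j ≫ i)
      have h2 : IsIso (j ≫ i) := lam.isIso_of_mono _
        (lam_eq_of_indecMeasure_eq lam hW hZ (le_antisymm h1 (hle.trans hcon))).ge
      have h3 : Epi i := epi_of_epi j i
      have h4 : Epi f := by rw [← hei]; exact epi_comp e i
      exact hf (lam.isIso_of_epi _
        (lam_eq_of_indecMeasure_eq lam hY hZ (le_antisymm (hcon.trans h1) hle)).le)) e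
  exact ⟨g ≫ i, by rw [← Category.assoc, hg, hei]⟩

end GRMeasure

section Sequence

variable {C : Type u} [Category.{v} C] [Abelian C] [IsLengthCategory C] (lam : LengthFunction C)
  (X : C)

theorem quotientSeq_succ (i : ℕ) : quotientSeq lam X (i + 1) =
    rejectQuotient lam (grMeasure lam (quotientSeq lam X i)) (quotientSeq lam X i) := rfl

theorem isZero_quotientSeq_succ {i : ℕ} (h : IsZero (quotientSeq lam X i)) :
    IsZero (quotientSeq lam X (i + 1)) := by
  rw [IsZero.iff_id_eq_zero, quotientSeq_succ, ← cancel_epi (rejectProj lam _ _)]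
  exact h.eq_of_src _ _

theorem isZero_quotientSeq_of_le {i j : ℕ} (hij : i ≤ j) (h : IsZero (quotientSeq lam X i)) :
    IsZero (quotientSeq lam X j) := by
  induction hij with
  | refl => exact h
  | step _ ih => exact isZero_quotientSeq_succ lam X ih

theorem grMeasure_quotientSeq_succ_lt {i : ℕ} (h : ¬ IsZero (quotientSeq lam X (i + 1))) :
    grMeasure lam (quotientSeq lam X (i + 1)) < grMeasure lam (quotientSeq lam X i) := by
  obtain ⟨W, hW, hWX, he⟩ := exists_indecMeasure_eq_grMeasure lam h
  rw [quotientSeq_succ] at hWX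
  obtain ⟨j, p, h⟩ := isSummand_iff.1 hWX
  have : IsSplitMono j := ⟨⟨p, h⟩⟩
  rw [← he]
  exact (cogeneratedLT_rejectQuotient lam _ _).indecMeasure_lt hW j

theorem not_isIso_rejectProj {Y : C} (h : ¬ IsZero Y) :
    ¬ IsIso (rejectProj lam (grMeasure lam Y) Y) := by
  intro hiso
  obtain ⟨W, hW, hWX, he⟩ := exists_indecMeasure_eq_grMeasure lam h
  obtain ⟨j, p, h⟩ := isSummand_iff.1 hWX
  have : IsSplitMono j := ⟨⟨p, h⟩⟩
  exact ((cogeneratedLT_rejectQuotient lam _ _).indecMeasure_lt hW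
    (j ≫ rejectProj lam (grMeasure lam Y) Y)).ne he

theorem exists_isZero_quotientSeq : ∃ n, IsZero (quotientSeq lam X n) := by
  suffices h : ∀ (Y : C) (i : ℕ), quotientSeq lam X i = Y → ∃ n, IsZero (quotientSeq lam X n) from
    h _ 0 rfl
  intro Y
  induction Y using quotient_induction with
  | h Y ih =>
    rintro i rfl
    by_cases hz : IsZero (quotientSeq lam X i)
    · exact ⟨i, hz⟩
    · exact ih (quotientSeq lam X (i + 1)) (rejectProj lam _ _)
        (inferInstanceAs (Epi (rejectProj lam _ _))) (not_isIso_rejectProj lam hz) (i + 1) rfl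

theorem isZero_quotientSeq_iff (i : ℕ) :
    IsZero (quotientSeq lam X i) ↔ numNonzero lam X ≤ i := by
  classical
  have hex := exists_isZero_quotientSeq lam X
  have h : ∀ i, IsZero (quotientSeq lam X i) ↔ Nat.find hex ≤ i := fun i =>
    ⟨fun h => Nat.find_min' hex h, fun h => isZero_quotientSeq_of_le lam X h (Nat.find_spec hex)⟩
  have hcard : numNonzero lam X = Nat.find hex := by
    have : {i : ℕ | ¬ IsZero (quotientSeq lam X i)} = ↑(Finset.range (Nat.find hex)) := by
      ext i
      rw [Set.mem_ofPred_eq, h, not_le, Finset.coe_range, Set.mem_Iio]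
    unfold numNonzero
    rw [this, Set.ncard_coe_finset, Finset.card_range]
  rw [h, hcard]

theorem grMeasure_quotientSeq_lt {i j : ℕ} (hij : i < j) (hj : j < numNonzero lam X) :
    grMeasure lam (quotientSeq lam X j) < grMeasure lam (quotientSeq lam X i) := by
  induction j, hij using Nat.le_induction with
  | base =>
    exact grMeasure_quotientSeq_succ_lt lam X fun h =>
      hj.not_ge ((isZero_quotientSeq_iff lam X _).1 h)
  | succ j hij ih =>
    exact (grMeasure_quotientSeq_succ_lt lam X fun h =>
      hj.not_ge ((isZero_quotientSeq_iff lam X _).1 h)).trans (ih (by lia))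

theorem exists_layer_of_isSummand {Y : C} (hY : Indecomposable Y) {i : ℕ}
    (h : IsSummand Y (quotientSeq lam X i)) :
    ∃ j < numNonzero lam X, indecMeasure lam Y = grMeasure lam (quotientSeq lam X j) ∧
      IsSummand Y (quotientSeq lam X j) := by
  induction hn : numNonzero lam X - i generalizing i with
  | zero =>
    exact absurd ((isZero_quotientSeq_iff lam X i).2 (by lia)) (h.not_isZero hY.1)
  | succ n ih =>
    rcases (indecMeasure_le_grMeasure lam hY h).eq_or_lt with he | hlt
    · exact ⟨i, by lia, he, h⟩
    · refine ih (i := i + 1) ?_ (by lia)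
      obtain ⟨k, p, hkp⟩ := isSummand_iff.1 h
      obtain ⟨g, hg⟩ := exists_factor_rejectProj lam
        (I := grMeasure lam (quotientSeq lam X i)) (V := Y)
        (CogeneratedLT.of_summands fun W hW hWY => lt_of_le_of_lt
          ((indecMeasure_le_grMeasure lam hW hWY).trans_eq (grMeasure_eq_indecMeasure lam hY)) hlt)
        p
      rw [quotientSeq_succ]
      exact isSummand_iff.2 ⟨k ≫ rejectProj lam _ _, g, by rw [Category.assoc, hg, hkp]⟩

theorem isSummand_totalObject (i : ℕ) (hi : i < numNonzero lam X) :
    IsSummand (quotientSeq lam X i) (totalObject lam X) := by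
  unfold totalObject
  exact isSummand_iff.2
    ⟨biproduct.ι (fun i : Fin (numNonzero lam X) => quotientSeq lam X i) ⟨i, hi⟩,
      biproduct.π (fun i : Fin (numNonzero lam X) => quotientSeq lam X i) ⟨i, hi⟩,
      biproduct.ι_π_self _ _⟩

theorem exists_isSummand_quotientSeq {Y : C} (hY : Indecomposable Y)
    (h : IsSummand Y (totalObject lam X)) : ∃ i, IsSummand Y (quotientSeq lam X i) :=
  (hY.exists_isSummand_of_biproduct lam h).imp' Fin.val fun _ h => h

end Sequence

section Layering

variable {C : Type u} [Category.{v} C] [Abelian C]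

/-- `Y` is a direct summand of a finite direct sum of copies of `E`. -/
def IsAddRetract (E Y : C) : Prop :=
  ∃ (J : Type) (_ : Fintype J) (i : J → (Y ⟶ E)) (p : J → (E ⟶ Y)), ∑ j, i j ≫ p j = 𝟙 Y

theorem IsSummand.isAddRetract {E Y : C} (h : IsSummand Y E) : IsAddRetract E Y := by
  obtain ⟨i, p, h⟩ := isSummand_iff.1 h
  exact ⟨Unit, inferInstance, fun _ => i, fun _ => p, by simpa using h⟩

theorem InAdd.isAddRetract {E Y : C} (h : InAdd E Y) : IsAddRetract E Y := by
  obtain ⟨n, h⟩ := h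
  obtain ⟨i, p, h⟩ := isSummand_iff.1 h
  refine ⟨Fin n, inferInstance, fun j => i ≫ biproduct.π (fun _ => E) j,
    fun j => biproduct.ι (fun _ => E) j ≫ p, ?_⟩
  have : ∑ j, (i ≫ biproduct.π (fun _ : Fin n => E) j) ≫ biproduct.ι (fun _ => E) j ≫ p =
      i ≫ (∑ j, biproduct.π (fun _ : Fin n => E) j ≫ biproduct.ι (fun _ => E) j) ≫ p := by
    simp only [Preadditive.sum_comp, Preadditive.comp_sum, Category.assoc]
  rw [this, biproduct.total]
  exact (congrArg _ (Category.id_comp _)).trans h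

theorem IsAddRetract.of_isSummand {E Y Z : C} (h : IsAddRetract E Y) (hZ : IsSummand Z Y) :
    IsAddRetract E Z := by
  obtain ⟨J, _, i, p, h⟩ := h
  obtain ⟨a, b, hab⟩ := isSummand_iff.1 hZ
  refine ⟨J, inferInstance, fun j => a ≫ i j, fun j => p j ≫ b, ?_⟩
  have : ∑ j, (a ≫ i j) ≫ p j ≫ b = a ≫ (∑ j, i j ≫ p j) ≫ b := by
    simp only [Preadditive.sum_comp, Preadditive.comp_sum, Category.assoc]
  rw [this, h, Category.id_comp, hab]

theorem IsAddRetract.biprod {E Y Z : C} (hY : IsAddRetract E Y) (hZ : IsAddRetract E Z) :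
    IsAddRetract E (Y ⊞ Z) := by
  obtain ⟨J, _, i, p, h⟩ := hY
  obtain ⟨J', _, i', p', h'⟩ := hZ
  refine ⟨J ⊕ J', inferInstance, Sum.elim (fun j => biprod.fst ≫ i j) (fun j => biprod.snd ≫ i' j),
    Sum.elim (fun j => p j ≫ biprod.inl) (fun j => p' j ≫ biprod.inr), ?_⟩
  have h1 : ∑ j, (biprod.fst ≫ i j) ≫ p j ≫ biprod.inl =
      (biprod.fst : Y ⊞ Z ⟶ Y) ≫ (∑ j, i j ≫ p j) ≫ (biprod.inl : Y ⟶ Y ⊞ Z) := by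
    simp only [Preadditive.sum_comp, Preadditive.comp_sum, Category.assoc]
  have h2 : ∑ j, (biprod.snd ≫ i' j) ≫ p' j ≫ biprod.inr =
      (biprod.snd : Y ⊞ Z ⟶ Z) ≫ (∑ j, i' j ≫ p' j) ≫ (biprod.inr : Z ⟶ Y ⊞ Z) := by
    simp only [Preadditive.sum_comp, Preadditive.comp_sum, Category.assoc]
  rw [Fintype.sum_sum_type]
  simp only [Sum.elim_inl, Sum.elim_inr]
  rw [h1, h2, h, h', Category.id_comp, Category.id_comp, biprod.total]

theorem IsAddRetract.isSummand_of_indecomposable [IsLengthCategory C] (lam : LengthFunction C)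
    {E Y : C} (h : IsAddRetract E Y) (hY : Indecomposable Y) : IsSummand Y E := by
  obtain ⟨J, _, i, p, h⟩ := h
  obtain ⟨j, hj⟩ := hY.exists_retract lam i p h
  refine isSummand_iff.2 ⟨i j, p j ≫ inv (i j ≫ p j), ?_⟩
  rw [← Category.assoc]
  exact IsIso.hom_inv_id _

/-- A layer function on the indecomposable direct summands of `E`, with quotients `Y ⟶ Q Y` into
higher layers through which all non-invertible morphisms to summands in the same or in higher
layers factor. -/
structure Layering (E : C) (ℓ : ℕ) where
  lay : C → ℕ
  lay_lt : ∀ {Y : C}, Indecomposable Y → IsSummand Y E → lay Y < ℓ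
  lay_iso : ∀ {Y Z : C}, Indecomposable Z → (Y ≅ Z) → lay Y = lay Z
  Q : C → C
  q : ∀ Y, Y ⟶ Q Y
  epi_q : ∀ Y, Epi (q Y)
  isAddRetract_Q : ∀ {Y : C}, Indecomposable Y → IsSummand Y E → IsAddRetract E (Q Y)
  lay_lt_of_isSummand_Q : ∀ {Y W : C}, Indecomposable Y → IsSummand Y E → Indecomposable W →
    IsSummand W (Q Y) → lay Y < lay W
  exists_factor : ∀ {Y Z : C}, Indecomposable Y → IsSummand Y E → Indecomposable Z →
    IsSummand Z E → lay Y ≤ lay Z → ∀ f : Y ⟶ Z, ¬ IsIso f → ∃ g, q Y ≫ g = f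

attribute [instance] Layering.epi_q

variable [IsLengthCategory C] (lam : LengthFunction C) (X : C)

/-- The index of the object of the sequence that has the measure of `Y`. -/
noncomputable def layer (Y : C) : ℕ :=
  sInf {i | i < numNonzero lam X ∧ indecMeasure lam Y = grMeasure lam (quotientSeq lam X i)}

theorem layer_spec {Y : C} (hY : Indecomposable Y) (h : IsSummand Y (totalObject lam X)) :
    layer lam X Y < numNonzero lam X ∧
      indecMeasure lam Y = grMeasure lam (quotientSeq lam X (layer lam X Y)) := by
  obtain ⟨i, hi⟩ := exists_isSummand_quotientSeq lam X hY h
  obtain ⟨j, hj, hj', -⟩ := exists_layer_of_isSummand lam X hY hi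
  exact Nat.sInf_mem (s := {i | i < numNonzero lam X ∧
    indecMeasure lam Y = grMeasure lam (quotientSeq lam X i)}) ⟨j, hj, hj'⟩

theorem eq_of_grMeasure_quotientSeq_eq {i j : ℕ} (hi : i < numNonzero lam X)
    (hj : j < numNonzero lam X)
    (h : grMeasure lam (quotientSeq lam X i) = grMeasure lam (quotientSeq lam X j)) : i = j := by
  rcases lt_trichotomy i j with hij | hij | hij
  · exact absurd h (grMeasure_quotientSeq_lt lam X hij hj).ne'
  · exact hij
  · exact absurd h (grMeasure_quotientSeq_lt lam X hij hi).ne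

theorem lt_of_grMeasure_quotientSeq_lt {i j : ℕ} (hi : i < numNonzero lam X)
    (h : grMeasure lam (quotientSeq lam X j) < grMeasure lam (quotientSeq lam X i)) : i < j := by
  rcases lt_trichotomy i j with hij | hij | hij
  · exact hij
  · exact absurd (hij ▸ h) (lt_irrefl _)
  · exact absurd h (grMeasure_quotientSeq_lt lam X hij hi).not_gt

theorem isSummand_quotientSeq_layer {Y : C} (hY : Indecomposable Y)
    (h : IsSummand Y (totalObject lam X)) : IsSummand Y (quotientSeq lam X (layer lam X Y)) := by
  obtain ⟨i, hi⟩ := exists_isSummand_quotientSeq lam X hY h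
  obtain ⟨j, hj, hj', hs⟩ := exists_layer_of_isSummand lam X hY hi
  obtain ⟨h1, h2⟩ := layer_spec lam X hY h
  rwa [eq_of_grMeasure_quotientSeq_eq lam X h1 hj (h2.symm.trans hj')]

/-- The layering of the indecomposable summands of `X̄` by the Gabriel-Roiter measure. -/
noncomputable def layering : Layering (totalObject lam X) (numNonzero lam X) where
  lay := layer lam X
  lay_lt hY h := (layer_spec lam X hY h).1
  lay_iso hZ e := by
    unfold layer
    rw [indecMeasure_eq_of_iso lam hZ e]
  Q Y := rejectQuotient lam (indecMeasure lam Y) Y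
  q Y := rejectProj lam (indecMeasure lam Y) Y
  epi_q _ := inferInstance
  isAddRetract_Q {Y} hY h := by
    have h1 := (isSummand_quotientSeq_layer lam X hY h).rejectQuotient lam (indecMeasure lam Y)
    by_cases hz : IsZero (rejectQuotient lam (indecMeasure lam Y) Y)
    · exact ⟨Empty, inferInstance, Empty.elim, Empty.elim, hz.eq_of_src _ _⟩
    · have h2 : rejectQuotient lam (indecMeasure lam Y) (quotientSeq lam X (layer lam X Y)) =
          quotientSeq lam X (layer lam X Y + 1) := by
        rw [quotientSeq_succ, ← (layer_spec lam X hY h).2]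
      rw [h2] at h1
      have h3 := h1.not_isZero hz
      rw [isZero_quotientSeq_iff, not_le] at h3
      exact (h1.trans (isSummand_totalObject lam X _ h3)).isAddRetract
  lay_lt_of_isSummand_Q {Y W} hY h hW hWQ := by
    obtain ⟨h1, h2⟩ := layer_spec lam X hY h
    have hWE : IsSummand W (totalObject lam X) := by
      have h3 := (isSummand_quotientSeq_layer lam X hY h).rejectQuotient lam (indecMeasure lam Y)
      have h4 : rejectQuotient lam (indecMeasure lam Y) (quotientSeq lam X (layer lam X Y)) =
          quotientSeq lam X (layer lam X Y + 1) := by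
        rw [quotientSeq_succ, ← (layer_spec lam X hY h).2]
      rw [h4] at h3
      have h5 := (hWQ.trans h3).not_isZero hW.1
      rw [isZero_quotientSeq_iff, not_le] at h5
      exact (hWQ.trans h3).trans (isSummand_totalObject lam X _ h5)
    obtain ⟨h3, h4⟩ := layer_spec lam X hW hWE
    refine lt_of_grMeasure_quotientSeq_lt lam X h1 ?_
    rw [← h2, ← h4]
    obtain ⟨j, p, hjp⟩ := isSummand_iff.1 hWQ
    have : IsSplitMono j := ⟨⟨p, hjp⟩⟩
    exact (cogeneratedLT_rejectQuotient lam _ _).indecMeasure_lt hW j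
  exists_factor {Y Z} hY h hZ hZE hle f hf := by
    obtain ⟨h1, h2⟩ := layer_spec lam X hY h
    obtain ⟨h3, h4⟩ := layer_spec lam X hZ hZE
    refine exists_factor_of_not_isIso lam hY hZ ?_ f hf
    by_contra! hcon
    rw [h2, h4] at hcon
    exact (lt_of_grMeasure_quotientSeq_lt lam X h3 hcon).not_ge hle

end Layering

section ProjectiveDimension

variable {R : Type v} [Ring R]

theorem shortExact_of_exact {A B D : Type v} [AddCommGroup A] [AddCommGroup B] [AddCommGroup D]
    [Module R A] [Module R B] [Module R D] (f : A →ₗ[R] B) (g : B →ₗ[R] D)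
    (hf : Function.Injective f) (hg : Function.Surjective g) (h : Function.Exact f g) :
    (ShortComplex.moduleCatMk f g h.linearMap_comp_eq_zero).ShortExact where
  exact := (ShortComplex.ShortExact.moduleCat_exact_iff_function_exact _).2 h
  mono_f := (ModuleCat.mono_iff_injective _).2 hf
  epi_g := (ModuleCat.epi_iff_surjective _).2 hg

theorem hasProjectiveDimensionLT_mid {A B D : Type v} [AddCommGroup A] [AddCommGroup B]
    [AddCommGroup D] [Module R A] [Module R B] [Module R D] (f : A →ₗ[R] B) (g : B →ₗ[R] D)
    (hf : Function.Injective f) (hg : Function.Surjective g) (h : Function.Exact f g) {n : ℕ}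
    (hA : HasProjectiveDimensionLT (ModuleCat.of R A) n)
    (hD : HasProjectiveDimensionLT (ModuleCat.of R D) n) :
    HasProjectiveDimensionLT (ModuleCat.of R B) n :=
  (shortExact_of_exact f g hf hg h).hasProjectiveDimensionLT_X₂ n hA hD

theorem hasProjectiveDimensionLT_right {A B D : Type v} [AddCommGroup A] [AddCommGroup B]
    [AddCommGroup D] [Module R A] [Module R B] [Module R D] (f : A →ₗ[R] B) (g : B →ₗ[R] D)
    (hf : Function.Injective f) (hg : Function.Surjective g) (h : Function.Exact f g) {n : ℕ}
    (hA : HasProjectiveDimensionLT (ModuleCat.of R A) n)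
    (hB : HasProjectiveDimensionLT (ModuleCat.of R B) (n + 1)) :
    HasProjectiveDimensionLT (ModuleCat.of R D) (n + 1) :=
  (shortExact_of_exact f g hf hg h).hasProjectiveDimensionLT_X₃ n hA hB

theorem hasProjectiveDimensionLT_left {A B D : Type v} [AddCommGroup A] [AddCommGroup B]
    [AddCommGroup D] [Module R A] [Module R B] [Module R D] (f : A →ₗ[R] B) (g : B →ₗ[R] D)
    (hf : Function.Injective f) (hg : Function.Surjective g) (h : Function.Exact f g) {n : ℕ}
    (hB : HasProjectiveDimensionLT (ModuleCat.of R B) n)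
    (hD : HasProjectiveDimensionLT (ModuleCat.of R D) (n + 1)) :
    HasProjectiveDimensionLT (ModuleCat.of R A) n :=
  (shortExact_of_exact f g hf hg h).hasProjectiveDimensionLT_X₁ n hB hD

theorem hasProjectiveDimensionLT_congr {A B : Type v} [AddCommGroup A] [AddCommGroup B]
    [Module R A] [Module R B] (e : A ≃ₗ[R] B) {n : ℕ}
    (h : HasProjectiveDimensionLT (ModuleCat.of R A) n) :
    HasProjectiveDimensionLT (ModuleCat.of R B) n :=
  hasProjectiveDimensionLT_of_iso e.toModuleIso n

theorem hasProjectiveDimensionLT_one_of_projective (A : Type v) [AddCommGroup A] [Module R A]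
    [Module.Projective R A] {n : ℕ} : HasProjectiveDimensionLT (ModuleCat.of R A) (n + 1) := by
  have : Projective (ModuleCat.of R A) := (IsProjective.iff_projective A).1 inferInstance
  exact hasProjectiveDimensionLT_of_ge _ 1 _ (by lia)

theorem hasProjectiveDimensionLT_dfinsupp_right {ι : Type v} {A B D : ι → Type v}
    [∀ i, AddCommGroup (A i)] [∀ i, AddCommGroup (B i)] [∀ i, AddCommGroup (D i)]
    [∀ i, Module R (A i)] [∀ i, Module R (B i)] [∀ i, Module R (D i)]
    (f : ∀ i, A i →ₗ[R] B i) (g : ∀ i, B i →ₗ[R] D i) (hf : ∀ i, Function.Injective (f i))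
    (hg : ∀ i, Function.Surjective (g i)) (h : ∀ i, Function.Exact (f i) (g i)) {n : ℕ}
    (hA : HasProjectiveDimensionLT (ModuleCat.of R (Π₀ i, A i)) n)
    (hB : HasProjectiveDimensionLT (ModuleCat.of R (Π₀ i, B i)) (n + 1)) :
    HasProjectiveDimensionLT (ModuleCat.of R (Π₀ i, D i)) (n + 1) := by
  refine hasProjectiveDimensionLT_right (A := Π₀ i, A i) (B := Π₀ i, B i) (D := Π₀ i, D i)
    (DFinsupp.mapRange.linearMap f) (DFinsupp.mapRange.linearMap g) ?_ ?_ ?_ hA hB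
  · exact (DFinsupp.mapRange_injective _ fun i => map_zero _).2 hf
  · exact (DFinsupp.mapRange_surjective _ fun i => map_zero _).2 hg
  · intro x
    constructor
    · intro hx
      choose y hy using fun i => (h i (x i)).1 (by simpa using DFunLike.congr_fun hx i)
      classical
      refine ⟨DFinsupp.mk x.support fun i => y i, ?_⟩
      ext i
      by_cases hi : x i = 0
      · simp [hi]
      · simp [hi, hy]
    · rintro ⟨y, rfl⟩
      ext i
      simpa using (h i).apply_apply_eq_zero (y i)

/-- Direct sums do not increase the projective dimension. -/
theorem hasProjectiveDimensionLE_dfinsupp {ι : Type v} (n : ℕ) (M : ι → Type v)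
    [∀ i, AddCommGroup (M i)] [∀ i, Module R (M i)]
    (h : ∀ i, HasProjectiveDimensionLE (ModuleCat.of R (M i)) n) :
    HasProjectiveDimensionLE (ModuleCat.of R (Π₀ i, M i)) n := by
  classical
  induction n generalizing M with
  | zero =>
    have : ∀ i, Module.Projective R (M i) := fun i => by
      have := h i
      have h2 : Projective (ModuleCat.of R (M i)) :=
        projective_iff_hasProjectiveDimensionLE_zero _ |>.2 this
      exact (IsProjective.iff_projective (M i)).2 h2
    exact hasProjectiveDimensionLT_one_of_projective _
  | succ n ih =>
    let p : ∀ i, (M i →₀ R) →ₗ[R] M i := fun i => Finsupp.linearCombination R id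
    have hp : ∀ i, Function.Surjective (p i) := fun i =>
      Finsupp.linearCombination_id_surjective R (M i)
    have hK : ∀ i, HasProjectiveDimensionLE (ModuleCat.of R (LinearMap.ker (p i))) n := fun i =>
      hasProjectiveDimensionLT_left (LinearMap.ker (p i)).subtype (p i)
        (Submodule.injective_subtype _) (hp i) (LinearMap.exact_subtype_ker_map _)
        (hasProjectiveDimensionLT_one_of_projective _) (h i)
    exact hasProjectiveDimensionLT_dfinsupp_right (A := fun i => LinearMap.ker (p i))
      (fun i => (LinearMap.ker (p i)).subtype) p (fun i => Submodule.injective_subtype _) hp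
      (fun i => LinearMap.exact_subtype_ker_map _) (ih _ hK)
      (hasProjectiveDimensionLT_one_of_projective _)

/-- Over a semiprimary ring, a property of modules that is inherited by submodules and
quotients bounds the projective dimension as soon as it does so for simple modules. -/
theorem hasProjectiveDimensionLE_of_simple [IsSemiprimaryRing R]
    {Q : ∀ (M : Type v) [AddCommGroup M] [Module R M], Prop}
    (hsub : ∀ (M N : Type v) [AddCommGroup M] [Module R M] [AddCommGroup N] [Module R N]
      (f : M →ₗ[R] N), Function.Injective f → Q N → Q M)
    (hquot : ∀ (M N : Type v) [AddCommGroup M] [Module R M] [AddCommGroup N] [Module R N]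
      (f : M →ₗ[R] N), Function.Surjective f → Q M → Q N) {n : ℕ}
    (hsimple : ∀ (S : Type v) [AddCommGroup S] [Module R S], IsSimpleModule R S → Q S →
      HasProjectiveDimensionLE (ModuleCat.of R S) n)
    (M : Type v) [AddCommGroup M] [Module R M] (hM : Q M) :
    HasProjectiveDimensionLE (ModuleCat.of R M) n := by
  refine IsSemiprimaryRing.induction ℤ R M
    (P := fun M _ _ _ => Q M → HasProjectiveDimensionLE (ModuleCat.of R M) n) ?_ ?_ hM
  · intro M _ _ _ _ _ _ hM
    obtain ⟨s, e, hs⟩ := isSemisimpleModule_iff_exists_linearEquiv_dfinsupp.1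
      (‹_› : IsSemisimpleModule R M)
    refine hasProjectiveDimensionLT_congr e.symm (hasProjectiveDimensionLE_dfinsupp n _ fun m => ?_)
    exact hsimple _ (hs m) (hsub _ _ m.1.subtype m.1.injective_subtype hM)
  · intro M _ _ _ _ N h1 h2 hM
    exact hasProjectiveDimensionLT_mid N.subtype N.mkQ N.injective_subtype N.mkQ_surjective
      (LinearMap.exact_subtype_mkQ N) (h1 (hsub _ _ N.subtype N.injective_subtype hM))
      (h2 (hquot _ _ N.mkQ N.mkQ_surjective hM))

end ProjectiveDimension

section HomModules

variable {C : Type u} [Category.{v} C] [Abelian C] (E : C)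

/-- Precomposition with `h`, as a map of left `End E`-modules. -/
def precomp {Z Y : C} (h : Z ⟶ Y) : (Y ⟶ E) →ₗ[End E] (Z ⟶ E) where
  toFun f := h ≫ f
  map_add' f g := Preadditive.comp_add _ _ _ _ _ _
  map_smul' r f := by simp only [End.smul_right, Category.assoc, RingHom.id_apply]

@[simp]
theorem precomp_apply {Z Y : C} (h : Z ⟶ Y) (f : Y ⟶ E) : precomp E h f = h ≫ f := rfl

theorem precomp_injective {Z Y : C} (h : Z ⟶ Y) [Epi h] : Function.Injective (precomp E h) :=
  fun _ _ hfg => (cancel_epi h).1 hfg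

theorem precomp_surjective {Z Y : C} (h : Z ⟶ Y) [IsSplitMono h] :
    Function.Surjective (precomp E h) :=
  fun f => ⟨retraction h ≫ f, by simp⟩

variable {E}

theorem IsAddRetract.projective {Y : C} (h : IsAddRetract E Y) :
    Module.Projective (End E) (Y ⟶ E) := by
  obtain ⟨J, _, i, p, h⟩ := h
  let a : (Y ⟶ E) →ₗ[End E] (J → End E) := LinearMap.pi fun j => precomp E (p j)
  let b : (J → End E) →ₗ[End E] (Y ⟶ E) :=
    ∑ j, (precomp E (i j) : End E →ₗ[End E] (Y ⟶ E)) ∘ₗ LinearMap.proj j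
  refine Module.Projective.of_split a b (LinearMap.ext fun f => ?_)
  simp only [a, b, LinearMap.comp_apply, LinearMap.sum_apply, LinearMap.pi_apply,
    LinearMap.proj_apply, LinearMap.id_apply]
  calc ∑ j, i j ≫ p j ≫ f = (∑ j, i j ≫ p j) ≫ f := by
        simp only [Preadditive.sum_comp, Category.assoc]
    _ = f := by rw [h, Category.id_comp]

theorem IsAddRetract.exists_precomp_eq {Y Z : C} (h : IsAddRetract E Y)
    (φ : (Y ⟶ E) →ₗ[End E] (Z ⟶ E)) : ∃ k : Z ⟶ Y, φ = precomp E k := by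
  obtain ⟨J, _, i, p, h⟩ := h
  refine ⟨∑ j, φ (i j) ≫ p j, LinearMap.ext fun f => ?_⟩
  have hf : f = ∑ j, i j ≫ p j ≫ f := by
    calc f = (∑ j, i j ≫ p j) ≫ f := by rw [h, Category.id_comp]
      _ = ∑ j, i j ≫ p j ≫ f := by simp only [Preadditive.sum_comp, Category.assoc]
  have hφ : ∀ j, φ (i j ≫ p j ≫ f) = φ (i j) ≫ p j ≫ f := fun j =>
    φ.map_smul (show End E from p j ≫ f) (i j)
  conv_lhs => rw [hf]
  simp only [map_sum, hφ, precomp_apply, Preadditive.sum_comp, Category.assoc]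

/-- A lift of a map from a projective module `Hom(Z, E)` to a quotient of `Hom(Y, E)`. -/
theorem IsAddRetract.exists_lift {Y Z : C} (h : IsAddRetract E Z)
    {N : Submodule (End E) (Y ⟶ E)} (φ : (Z ⟶ E) →ₗ[End E] ((Y ⟶ E) ⧸ N)) :
    ∃ k : Y ⟶ Z, φ = N.mkQ ∘ₗ precomp E k := by
  have := h.projective
  obtain ⟨g, hg⟩ := Module.projective_lifting_property N.mkQ φ N.mkQ_surjective
  obtain ⟨k, rfl⟩ := h.exists_precomp_eq g
  exact ⟨k, hg.symm⟩

variable [IsLengthCategory C] (lam : LengthFunction C)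

include lam in
theorem isSplitMono_or_of_add {Y Z : C} (hY : Indecomposable Y) (f g : Y ⟶ Z)
    (h : IsSplitMono (f + g)) : IsSplitMono f ∨ IsSplitMono g := by
  have h1 : IsIso (f ≫ retraction (f + g) + g ≫ retraction (f + g)) := by
    rw [← Preadditive.add_comp, IsSplitMono.id]; infer_instance
  have h2 : ∀ k : Y ⟶ Z, IsIso (k ≫ retraction (f + g)) → IsSplitMono k := fun k hk =>
    ⟨⟨retraction (f + g) ≫ inv (k ≫ retraction (f + g)), by
      rw [← Category.assoc]; exact IsIso.hom_inv_id _⟩⟩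
  exact (hY.isIso_or_isIso_of_add lam _ _ h1).imp (h2 f) (h2 g)

omit [IsLengthCategory C] in
theorem not_isSplitMono_zero {Y : C} (hY : Indecomposable Y) : ¬ IsSplitMono (0 : Y ⟶ E) := by
  intro h
  refine hY.1 ((IsZero.iff_id_eq_zero Y).2 ?_)
  rw [← IsSplitMono.id (0 : Y ⟶ E), zero_comp]

/-- The module of morphisms `Y ⟶ E` that are not split monomorphisms. -/
def nonSplit {Y : C} (hY : Indecomposable Y) : Submodule (End E) (Y ⟶ E) where
  carrier := {f | ¬ IsSplitMono f}
  add_mem' {f g} hf hg := fun h => (isSplitMono_or_of_add lam hY f g h).elim hf hg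
  zero_mem' := not_isSplitMono_zero hY
  smul_mem' r f hf := fun h => hf
    ⟨⟨r ≫ retraction (r • f), by rw [← Category.assoc]; exact IsSplitMono.id (r • f)⟩⟩

theorem mem_nonSplit {Y : C} (hY : Indecomposable Y) (f : Y ⟶ E) :
    f ∈ nonSplit lam hY ↔ ¬ IsSplitMono f := Iff.rfl

omit [IsLengthCategory C] in
theorem eq_top_of_isSplitMono_mem {Y : C} {N : Submodule (End E) (Y ⟶ E)} {f : Y ⟶ E}
    (hf : IsSplitMono f) (hN : f ∈ N) : N = ⊤ := by
  refine eq_top_iff.2 fun g _ => ?_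
  have : g = (show End E from retraction f ≫ g) • f := by
    rw [End.smul_right, ← Category.assoc, IsSplitMono.id, Category.id_comp]
  rw [this]
  exact N.smul_mem _ hN

theorem le_nonSplit {Y : C} (hY : Indecomposable Y) {N : Submodule (End E) (Y ⟶ E)} (hN : N ≠ ⊤) :
    N ≤ nonSplit lam hY :=
  fun _ hf h => hN (eq_top_of_isSplitMono_mem h hf)

theorem isCoatom_nonSplit {Y : C} (hY : Indecomposable Y) (h : IsSummand Y E) :
    IsCoatom (nonSplit (E := E) lam hY) := by
  refine ⟨fun htop => ?_, fun N hN => ?_⟩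
  · obtain ⟨i, p, h⟩ := isSummand_iff.1 h
    have : i ∈ nonSplit lam hY := htop ▸ Submodule.mem_top
    exact this ⟨⟨p, h⟩⟩
  · by_contra hne
    exact hN.not_ge (le_nonSplit lam hY hne)

theorem jacobson_eq_nonSplit {Y : C} (hY : Indecomposable Y) (h : IsSummand Y E) :
    Module.jacobson (End E) (Y ⟶ E) = nonSplit lam hY := by
  refine le_antisymm (sInf_le (isCoatom_nonSplit lam hY h)) (le_sInf fun N hN => ?_)
  exact ((hN.le_iff.1 (le_nonSplit lam hY hN.1)).resolve_left (isCoatom_nonSplit lam hY h).1).le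

include lam

theorem isCoatom_jacobson {Y : C} (hY : Indecomposable Y) (h : IsSummand Y E) :
    IsCoatom (Module.jacobson (End E) (Y ⟶ E)) :=
  jacobson_eq_nonSplit lam hY h ▸ isCoatom_nonSplit lam hY h

theorem eq_jacobson_of_isCoatom {Y : C} (hY : Indecomposable Y) (h : IsSummand Y E)
    {N : Submodule (End E) (Y ⟶ E)} (hN : IsCoatom N) : N = Module.jacobson (End E) (Y ⟶ E) :=
  (((isCoatom_jacobson lam hY h).le_iff.1 (sInf_le (a := N) hN)).resolve_left hN.1)

theorem isSimpleModule_top {Y : C} (hY : Indecomposable Y) (h : IsSummand Y E) :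
    IsSimpleModule (End E) (moduleTop (End E) (Y ⟶ E)) :=
  isSimpleModule_iff_isCoatom.2 (isCoatom_jacobson lam hY h)

theorem comp_mem_jacobson {Y Z : C} (hY : Indecomposable Y) (hYE : IsSummand Y E)
    (hZ : Indecomposable Z) (k : Y ⟶ Z) (hk : ¬ IsIso k) (f : Z ⟶ E) :
    k ≫ f ∈ Module.jacobson (End E) (Y ⟶ E) := by
  rw [jacobson_eq_nonSplit lam hY hYE, mem_nonSplit]
  intro h
  refine hk (hZ.isIso_of_retract hY.1 (p := f ≫ retraction (k ≫ f)) ?_)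
  rw [← Category.assoc]
  exact IsSplitMono.id _

theorem nonempty_iso_of_top {Y Z : C} (hY : Indecomposable Y) (hYE : IsSummand Y E)
    (hZ : Indecomposable Z) (hZE : IsSummand Z E)
    (e : moduleTop (End E) (Y ⟶ E) ≃ₗ[End E] moduleTop (End E) (Z ⟶ E)) : Nonempty (Y ≅ Z) := by
  obtain ⟨k, hk⟩ := hYE.isAddRetract.exists_lift (Y := Z)
    (e.toLinearMap ∘ₗ (Module.jacobson (End E) (Y ⟶ E)).mkQ)
  by_cases hiso : IsIso k
  · exact ⟨(asIso k).symm⟩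
  exfalso
  have h0 : e.toLinearMap ∘ₗ (Module.jacobson (End E) (Y ⟶ E)).mkQ = 0 := by
    rw [hk]
    refine LinearMap.ext fun f => ?_
    exact (Submodule.Quotient.mk_eq_zero _).2 (comp_mem_jacobson lam hZ hZE hY k hiso f)
  refine (isCoatom_jacobson lam hY hYE).1 (eq_top_iff.2 fun f _ => ?_)
  have := LinearMap.congr_fun h0 f
  simpa using this

theorem exists_top_equiv_of_simple (d : IndecDecomposition E) (S : Type v) [AddCommGroup S]
    [Module (End E) S] (hS : IsSimpleModule (End E) S) :
    ∃ j, Nonempty (S ≃ₗ[End E] moduleTop (End E) (d.obj j ⟶ E)) := by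
  have := IsSimpleModule.nontrivial (End E) S
  obtain ⟨s, hs⟩ := exists_ne (0 : S)
  let φ : End E →ₗ[End E] S := LinearMap.toSpanSingleton (End E) S s
  obtain ⟨j, hj⟩ : ∃ j, φ ∘ₗ (precomp E (d.π j) : (d.obj j ⟶ E) →ₗ[End E] End E) ≠ 0 := by
    by_contra! hcon
    refine hs ?_
    have h1 : (1 : End E) = ∑ j, d.π j ≫ d.ι j := d.total.symm
    have h2 : φ 1 = s := LinearMap.toSpanSingleton_apply_one _ _ _
    rw [← h2, h1]
    refine (map_sum φ _ _).trans (Finset.sum_eq_zero fun j _ => ?_)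
    exact LinearMap.congr_fun (hcon j) (d.ι j)
  let ψ := φ ∘ₗ (precomp E (d.π j) : (d.obj j ⟶ E) →ₗ[End E] End E)
  have hsurj : Function.Surjective ψ := LinearMap.surjective_of_ne_zero hj
  have hker : IsCoatom (LinearMap.ker ψ) := by
    rw [← isSimpleModule_iff_isCoatom]
    exact IsSimpleModule.congr (ψ.quotKerEquivOfSurjective hsurj)
  have heq := eq_jacobson_of_isCoatom lam (d.indec j) (d.isSummand j) hker
  exact ⟨j, ⟨(ψ.quotKerEquivOfSurjective hsurj).symm.trans (Submodule.quotEquivOfEq _ _ heq)⟩⟩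

theorem exists_indec_top_equiv_of_simple (S : Type v) [AddCommGroup S]
    [Module (End E) S] (hS : IsSimpleModule (End E) S) :
    ∃ Y : C, Indecomposable Y ∧ IsSummand Y E ∧
      Nonempty (S ≃ₗ[End E] moduleTop (End E) (Y ⟶ E)) := by
  obtain ⟨d⟩ := exists_indecDecomposition E
  obtain ⟨j, hj⟩ := exists_top_equiv_of_simple lam d S hS
  exact ⟨_, d.indec j, d.isSummand j, hj⟩

end HomModules

section Semiprimary

variable {C : Type u} [Category.{v} C] [Abelian C] [IsLengthCategory C] (lam : LengthFunction C)
  {E : C}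

include lam in
theorem isSemisimpleModule_quotient_jacobson :
    IsSemisimpleModule (End E) (End E ⧸ Ring.jacobson (End E)) := by
  obtain ⟨d⟩ := exists_indecDecomposition E
  let J := Ring.jacobson (End E)
  let ψ : ∀ j, (d.obj j ⟶ E) →ₗ[End E] (End E ⧸ J) := fun j => J.mkQ ∘ₗ
    (precomp E (d.π j) : (d.obj j ⟶ E) →ₗ[End E] End E)
  have hsimple : ∀ j, IsSemisimpleModule (End E) (LinearMap.range (ψ j)) := fun j => by
    have h1 := isSimpleModule_top lam (d.indec j) (d.isSummand j)
    have hle : Module.jacobson (End E) (d.obj j ⟶ E) ≤ LinearMap.ker (ψ j) := fun f hf =>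
      (Submodule.Quotient.mk_eq_zero _).2 (Module.le_comap_jacobson
        (precomp E (d.π j) : (d.obj j ⟶ E) →ₗ[End E] End E) hf)
    rw [← Submodule.range_liftQ _ _ hle]
    exact IsSemisimpleModule.range _
  have htop : ⨆ j, LinearMap.range (ψ j) = ⊤ := by
    refine eq_top_iff.2 fun x _ => ?_
    obtain ⟨f, rfl⟩ := J.mkQ_surjective x
    have hf : f = ∑ j, d.π j ≫ d.ι j ≫ f := by
      calc f = (𝟙 E) ≫ f := (Category.id_comp _).symm
        _ = _ := by rw [← d.total]; simp only [Preadditive.sum_comp, Category.assoc]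
    rw [hf]
    refine (map_sum J.mkQ (fun j => d.π j ≫ d.ι j ≫ f) Finset.univ).symm ▸
      Submodule.sum_mem _ fun j _ => ?_
    exact Submodule.mem_iSup_of_mem j ⟨d.ι j ≫ f, rfl⟩
  exact isSemisimpleModule_of_isSemisimpleModule_submodule' hsimple htop

include lam in
theorem isSemisimpleRing_quotient_jacobson :
    IsSemisimpleRing (End E ⧸ Ring.jacobson (End E)) := by
  have := isSemisimpleModule_quotient_jacobson lam (E := E)
  let f : (End E ⧸ Ring.jacobson (End E)) →ₛₗ[Ideal.Quotient.mk (Ring.jacobson (End E))]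
    (End E ⧸ Ring.jacobson (End E)) := ⟨AddHom.id _, fun _ _ => rfl⟩
  exact (f.isSemisimpleModule_iff_of_bijective Function.bijective_id).1 this

include lam in
theorem not_isIso_of_mem_jacobson {γ : End E} (hγ : γ ∈ Ring.jacobson (End E)) {Y Z : C}
    (hY : Indecomposable Y) (i : Y ⟶ E) (p : E ⟶ Z) : ¬ IsIso (i ≫ γ ≫ p) := by
  intro h
  have h1 := IsIso.hom_inv_id (i ≫ γ ≫ p)
  have hi : IsSplitMono (i ≫ γ) := ⟨⟨p ≫ inv (i ≫ γ ≫ p), by simpa only [Category.assoc] using h1⟩⟩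
  have hs : IsSummand Y E :=
    isSummand_iff.2 ⟨i, γ ≫ p ≫ inv (i ≫ γ ≫ p), by simpa only [Category.assoc] using h1⟩
  have h2 := Module.le_comap_jacobson (precomp E i : End E →ₗ[End E] (Y ⟶ E)) hγ
  rw [jacobson_eq_nonSplit lam hY hs] at h2
  exact h2 hi

/-- `f` factors through a finite direct sum of indecomposable summands of `E` in layers `≥ k`. -/
def FactorsThroughLayers {ℓ : ℕ} (L : Layering E ℓ) (k : ℕ) {A B : C} (f : A ⟶ B) : Prop :=
  ∃ (J : Type) (_ : Fintype J) (V : J → C) (a : ∀ j, A ⟶ V j) (b : ∀ j, V j ⟶ B),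
    (∀ j, Indecomposable (V j) ∧ IsSummand (V j) E ∧ k ≤ L.lay (V j)) ∧ ∑ j, a j ≫ b j = f

namespace FactorsThroughLayers

variable {ℓ : ℕ} {L : Layering E ℓ} {k : ℕ}

omit [IsLengthCategory C] in
theorem comp {A B D : C} {f : A ⟶ B} (hf : FactorsThroughLayers L k f) (g : B ⟶ D) :
    FactorsThroughLayers L k (f ≫ g) := by
  obtain ⟨J, _, V, a, b, hV, rfl⟩ := hf
  exact ⟨J, inferInstance, V, a, fun j => b j ≫ g, hV, by
    simp only [Preadditive.sum_comp, Category.assoc]⟩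

omit [IsLengthCategory C] in
theorem precomp {A B D : C} {f : A ⟶ B} (hf : FactorsThroughLayers L k f) (g : D ⟶ A) :
    FactorsThroughLayers L k (g ≫ f) := by
  obtain ⟨J, _, V, a, b, hV, rfl⟩ := hf
  exact ⟨J, inferInstance, V, fun j => g ≫ a j, b, hV, by
    simp only [Preadditive.comp_sum, Category.assoc]⟩

omit [IsLengthCategory C] in
theorem zero {A B : C} : FactorsThroughLayers L k (0 : A ⟶ B) :=
  ⟨Empty, inferInstance, Empty.elim, fun j => j.elim, fun j => j.elim, fun j => j.elim, by simp⟩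

omit [IsLengthCategory C] in
theorem add {A B : C} {f g : A ⟶ B} (hf : FactorsThroughLayers L k f)
    (hg : FactorsThroughLayers L k g) : FactorsThroughLayers L k (f + g) := by
  obtain ⟨J, _, V, a, b, hV, rfl⟩ := hf
  obtain ⟨J', _, V', a', b', hV', rfl⟩ := hg
  refine ⟨J ⊕ J', inferInstance, Sum.elim V V', Sum.rec a a', Sum.rec b b', Sum.rec hV hV', ?_⟩
  rw [Fintype.sum_sum_type]
  rfl

omit [IsLengthCategory C] in
theorem sum {A B : C} {J : Type} (s : Finset J) (f : J → (A ⟶ B))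
    (hf : ∀ j ∈ s, FactorsThroughLayers L k (f j)) :
    FactorsThroughLayers L k (∑ j ∈ s, f j) :=
  Finset.sum_induction f (FactorsThroughLayers L k) (fun _ _ => add) zero hf

omit [IsLengthCategory C] in
theorem eq_zero {A B : C} {f : A ⟶ B} (hf : FactorsThroughLayers L ℓ f) : f = 0 := by
  obtain ⟨J, _, V, a, b, hV, rfl⟩ := hf
  exact Finset.sum_eq_zero fun j _ => absurd (L.lay_lt (hV j).1 (hV j).2.1) (hV j).2.2.not_gt

theorem of_end (f : E ⟶ E) : FactorsThroughLayers L 0 f := by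
  obtain ⟨d⟩ := exists_indecDecomposition E
  refine ⟨d.J, inferInstance, d.obj, d.π, fun j => d.ι j ≫ f,
    fun j => ⟨d.indec j, d.isSummand j, Nat.zero_le _⟩, ?_⟩
  calc ∑ j, d.π j ≫ d.ι j ≫ f = (∑ j, d.π j ≫ d.ι j) ≫ f := by
        simp only [Preadditive.sum_comp, Category.assoc]
    _ = f := by rw [d.total, Category.id_comp]

include lam in
theorem comp_jacobson_comp {A B : C} {f : A ⟶ E} {g : E ⟶ B} (hf : FactorsThroughLayers L k f)
    (hg : FactorsThroughLayers L k g) {γ : End E} (hγ : γ ∈ Ring.jacobson (End E)) :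
    FactorsThroughLayers L (k + 1) (f ≫ γ ≫ g) := by
  obtain ⟨J, _, V, a, b, hV, rfl⟩ := hf
  obtain ⟨J', _, V', a', b', hV', rfl⟩ := hg
  have : (∑ j, a j ≫ b j) ≫ γ ≫ (∑ j', a' j' ≫ b' j') =
      ∑ j, ∑ j', a j ≫ (b j ≫ γ ≫ a' j') ≫ b' j' := by
    simp only [Preadditive.sum_comp, Preadditive.comp_sum, Category.assoc]
    exact Finset.sum_comm
  rw [this]
  refine sum _ _ fun j _ => sum _ _ fun j' _ => (comp ?_ (b' j')).precomp (a j)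
  obtain ⟨hj, hjE, hjk⟩ := hV j
  obtain ⟨hj', hjE', hjk'⟩ := hV' j'
  by_cases hlt : k + 1 ≤ L.lay (V j)
  · exact ⟨Unit, inferInstance, fun _ => V j, fun _ => 𝟙 _, fun _ => b j ≫ γ ≫ a' j',
      fun _ => ⟨hj, hjE, hlt⟩, by simp⟩
  · obtain ⟨g, hg⟩ := L.exists_factor hj hjE hj' hjE' (by lia) (b j ≫ γ ≫ a' j')
      (not_isIso_of_mem_jacobson lam hγ hj _ _)
    rw [← hg]
    obtain ⟨d⟩ := exists_indecDecomposition (L.Q (V j))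
    refine ⟨d.J, inferInstance, d.obj, fun l => L.q (V j) ≫ d.π l, fun l => d.ι l ≫ g,
      fun l => ⟨d.indec l, ?_, ?_⟩, ?_⟩
    · exact ((L.isAddRetract_Q hj hjE).of_isSummand (d.isSummand l)).isSummand_of_indecomposable
        lam (d.indec l)
    · have := L.lay_lt_of_isSummand_Q hj hjE (d.indec l) (d.isSummand l)
      lia
    · calc ∑ l, (L.q (V j) ≫ d.π l) ≫ d.ι l ≫ g = L.q (V j) ≫ (∑ l, d.π l ≫ d.ι l) ≫ g := by
            simp only [Preadditive.sum_comp, Preadditive.comp_sum, Category.assoc]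
        _ = _ := by rw [d.total, Category.id_comp]

end FactorsThroughLayers

include lam in
theorem exists_jacobson_pow_factors {ℓ : ℕ} (L : Layering E ℓ) (k : ℕ) :
    ∃ m : ℕ, ∀ γ ∈ Ring.jacobson (End E) ^ m, FactorsThroughLayers L k (A := E) (B := E) γ := by
  induction k with
  | zero => exact ⟨0, fun γ _ => FactorsThroughLayers.of_end γ⟩
  | succ k ih =>
    obtain ⟨m, hm⟩ := ih
    refine ⟨m + 1 + m, fun γ hγ => ?_⟩
    rw [Ideal.IsTwoSided.pow_add, Ideal.IsTwoSided.pow_add, Submodule.pow_one] at hγ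
    refine Submodule.smul_induction_on hγ (fun r hr n hn => ?_)
      (fun x y hx hy => FactorsThroughLayers.add hx hy)
    refine Submodule.smul_induction_on hr (fun s hs t ht => ?_) (fun x y hx hy => ?_)
    · exact FactorsThroughLayers.comp_jacobson_comp lam (hm n hn) (hm s hs) ht
    · rw [add_smul]
      exact FactorsThroughLayers.add hx hy

include lam in
theorem isSemiprimaryRing_end {ℓ : ℕ} (L : Layering E ℓ) : IsSemiprimaryRing (End E) where
  isSemisimpleRing := isSemisimpleRing_quotient_jacobson lam
  isNilpotent := by
    obtain ⟨m, hm⟩ := exists_jacobson_pow_factors lam L ℓ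
    exact ⟨m, eq_bot_iff.2 fun γ hγ => (Submodule.mem_bot _).2 (hm γ hγ).eq_zero⟩

end Semiprimary

section Representatives

variable {C : Type u} [Category.{v} C] [Abelian C]

/-- A complete irredundant list of the indecomposable direct summands of `E`. -/
structure Representatives (E : C) where
  Φ : Type
  obj : Φ → C
  indec : ∀ φ, Indecomposable (obj φ)
  isSummand : ∀ φ, IsSummand (obj φ) E
  eq_of_iso : ∀ φ ψ, Nonempty (obj φ ≅ obj ψ) → φ = ψ
  exists_iso : ∀ Y : C, Indecomposable Y → IsSummand Y E → ∃ φ, Nonempty (Y ≅ obj φ)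

theorem exists_representatives [IsLengthCategory C] (lam : LengthFunction C) (E : C) :
    Nonempty (Representatives E) := by
  obtain ⟨d⟩ := exists_indecDecomposition E
  let s : Setoid d.J :=
    ⟨fun i j => Nonempty (d.obj i ≅ d.obj j), fun _ => ⟨Iso.refl _⟩, fun ⟨e⟩ => ⟨e.symm⟩,
      fun ⟨e⟩ ⟨f⟩ => ⟨e.trans f⟩⟩
  refine ⟨⟨Quotient s, fun φ => d.obj φ.out, fun φ => d.indec _, fun φ => d.isSummand _,
    fun φ ψ h => ?_, fun Y hY hYE => ?_⟩⟩
  · rw [← Quotient.out_eq φ, ← Quotient.out_eq ψ]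
    exact Quotient.sound h
  · obtain ⟨i, p, h⟩ := isSummand_iff.1 hYE
    obtain ⟨j, hj⟩ := hY.exists_retract lam (fun j => i ≫ d.π j) (fun j => d.ι j ≫ p) (by
      calc ∑ j, (i ≫ d.π j) ≫ d.ι j ≫ p = i ≫ (∑ j, d.π j ≫ d.ι j) ≫ p := by
            simp only [Preadditive.sum_comp, Preadditive.comp_sum, Category.assoc]
        _ = 𝟙 Y := by rw [d.total, Category.id_comp, h])
    have hiso : IsIso (i ≫ d.π j) := (d.indec j).isIso_of_retract hY.1
      (p := (d.ι j ≫ p) ≫ inv ((i ≫ d.π j) ≫ d.ι j ≫ p)) (by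
        rw [← Category.assoc]; exact IsIso.hom_inv_id _)
    have h2 : Nonempty (d.obj (Quotient.mk s j).out ≅ d.obj j) := Quotient.mk_out (s := s) j
    exact ⟨Quotient.mk s j, ⟨asIso (i ≫ d.π j) ≪≫ h2.some.symm⟩⟩

/-- The partial order in which `φ < ψ` iff the layer of `φ` is smaller than that of `ψ`. -/
@[reducible]
def Representatives.partialOrder {E : C} (T : Representatives E) {ℓ : ℕ} (L : Layering E ℓ) :
    PartialOrder T.Φ where
  le φ ψ := φ = ψ ∨ L.lay (T.obj φ) < L.lay (T.obj ψ)
  le_refl φ := Or.inl rfl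
  le_trans φ ψ χ h₁ h₂ := by
    rcases h₁ with rfl | h₁
    · exact h₂
    · rcases h₂ with rfl | h₂
      · exact Or.inr h₁
      · exact Or.inr (h₁.trans h₂)
  le_antisymm φ ψ h₁ h₂ := by
    rcases h₁ with rfl | h₁
    · rfl
    · rcases h₂ with h₂ | h₂
      · exact h₂.symm
      · exact absurd h₁ h₂.not_gt

theorem Representatives.lt_iff {E : C} (T : Representatives E) {ℓ : ℕ} (L : Layering E ℓ)
    {φ ψ : T.Φ} : (T.partialOrder L).lt φ ψ ↔ L.lay (T.obj φ) < L.lay (T.obj ψ) := by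
  let := T.partialOrder L
  change φ < ψ ↔ _
  rw [lt_iff_le_and_ne]
  constructor
  · rintro ⟨h | h, hne⟩
    · exact absurd h hne
    · exact h
  · intro h
    exact ⟨Or.inr h, fun he => (he ▸ h).false⟩

variable [IsLengthCategory C] (lam : LengthFunction C) {E : C}

/-- The labelling of the simple `End E`-modules by the indecomposable summands of `E`. -/
noncomputable def Representatives.labelling (T : Representatives E) :
    SimpleLabelling (End E) T.Φ where
  P φ := ModuleCat.of (End E) (T.obj φ ⟶ E)
  projective φ := (T.isSummand φ).isAddRetract.projective
  isSimple_top φ := isSimpleModule_top lam (T.indec φ) (T.isSummand φ)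
  eq_of_iso φ ψ h := T.eq_of_iso φ ψ (nonempty_iso_of_top lam (T.indec φ) (T.isSummand φ)
    (T.indec ψ) (T.isSummand ψ) h.some)
  exists_iso S _ _ hS := by
    obtain ⟨Y, hY, hYE, ⟨e⟩⟩ := exists_indec_top_equiv_of_simple lam S hS
    obtain ⟨φ, ⟨f⟩⟩ := T.exists_iso Y hY hYE
    have hb : Function.Bijective (precomp E f.inv) :=
      ⟨precomp_injective E f.inv, precomp_surjective E f.inv⟩
    refine ⟨φ, ⟨e.trans (Submodule.Quotient.equiv _ _ (LinearEquiv.ofBijective _ hb) ?_)⟩⟩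
    exact Module.map_jacobson_of_bijective hb

end Representatives

section Standard

variable {C : Type u} [Category.{v} C] [Abelian C] [IsLengthCategory C] (lam : LengthFunction C)
  {E : C} {ℓ : ℕ} (L : Layering E ℓ) (T : Representatives E)

/-- The submodule of `Hom(Y, E)` of the morphisms that factor through `Y ⟶ Q Y`. -/
def lowerHom (Y : C) : Submodule (End E) (Y ⟶ E) := LinearMap.range (precomp E (L.q Y))

omit [IsLengthCategory C] in
theorem precomp_mem_lowerHom {Y Z : C} (hY : Indecomposable Y) (hYE : IsSummand Y E)
    (hZ : Indecomposable Z) (hZE : IsSummand Z E) (hle : L.lay Y ≤ L.lay Z) (k : Y ⟶ Z)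
    (hk : ¬ IsIso k) (f : Z ⟶ E) : precomp E k f ∈ lowerHom L Y := by
  obtain ⟨g, rfl⟩ := L.exists_factor hY hYE hZ hZE hle k hk
  exact ⟨g ≫ f, by simp⟩

theorem labelling_U (φ : T.Φ) :
    letI := T.partialOrder L
    (T.labelling lam).U φ = lowerHom L (T.obj φ) := by
  let := T.partialOrder L
  refine le_antisymm ?_ ?_
  · refine iSup_le fun ψ => iSup_le fun hψ => iSup_le fun f => ?_
    have hne : ψ ≠ φ := fun h => hψ (Or.inl h)
    have hle : L.lay (T.obj φ) ≤ L.lay (T.obj ψ) := not_lt.1 fun h => hψ (Or.inr h)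
    obtain ⟨k, rfl⟩ := (T.isSummand ψ).isAddRetract.exists_precomp_eq
      (show (T.obj ψ ⟶ E) →ₗ[End E] (T.obj φ ⟶ E) from f)
    rintro _ ⟨f, rfl⟩
    exact precomp_mem_lowerHom L (T.indec φ) (T.isSummand φ) (T.indec ψ) (T.isSummand ψ) hle k
      (fun h => hne (T.eq_of_iso ψ φ ⟨(asIso k).symm⟩)) f
  · rintro _ ⟨f, rfl⟩
    obtain ⟨d⟩ := exists_indecDecomposition (L.Q (T.obj φ))
    have hf : precomp E (L.q (T.obj φ)) f =
        ∑ j, L.q (T.obj φ) ≫ d.π j ≫ d.ι j ≫ f := by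
      calc L.q (T.obj φ) ≫ f = L.q (T.obj φ) ≫ (∑ j, d.π j ≫ d.ι j) ≫ f := by
            rw [d.total, Category.id_comp]
        _ = _ := by simp only [Preadditive.sum_comp, Preadditive.comp_sum, Category.assoc]
    rw [hf]
    refine Submodule.sum_mem _ fun j _ => ?_
    have hs := ((L.isAddRetract_Q (T.indec φ) (T.isSummand φ)).of_isSummand
      (d.isSummand j)).isSummand_of_indecomposable lam (d.indec j)
    obtain ⟨ψ, ⟨e⟩⟩ := T.exists_iso _ (d.indec j) hs
    have hlt := L.lay_lt_of_isSummand_Q (T.indec φ) (T.isSummand φ) (d.indec j) (d.isSummand j)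
    rw [L.lay_iso (T.indec ψ) e] at hlt
    have hψ : ¬ ψ ≤ φ := fun h => h.elim (fun h => (h ▸ hlt).false) fun h => h.not_gt hlt
    refine Submodule.mem_iSup_of_mem ψ (Submodule.mem_iSup_of_mem hψ
      (Submodule.mem_iSup_of_mem
        (precomp E (L.q (T.obj φ) ≫ d.π j ≫ e.hom)) ⟨e.inv ≫ d.ι j ≫ f, ?_⟩))
    exact (precomp_apply _ _ _).trans (by simp)

theorem nonempty_quotient_equiv {R : Type*} [Ring R] {A B : Type*} [AddCommGroup A]
    [AddCommGroup B] [Module R A] [Module R B] (f : A →ₗ[R] B) {N N' : Submodule R B}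
    {K : Submodule R A} (h₁ : ∀ a, f a ∈ N') (h₂ : ∀ b ∈ N', ∃ a, b - f a ∈ N)
    (h₃ : ∀ a, f a ∈ N ↔ a ∈ K) : Nonempty ((N' ⧸ N.submoduleOf N') ≃ₗ[R] A ⧸ K) := by
  let g : A →ₗ[R] N' ⧸ N.submoduleOf N' := (N.submoduleOf N').mkQ ∘ₗ f.codRestrict N' h₁
  have hg : Function.Surjective g := by
    intro x
    obtain ⟨b, rfl⟩ := (N.submoduleOf N').mkQ_surjective x
    obtain ⟨a, ha⟩ := h₂ b.1 b.2
    refine ⟨a, ((Submodule.Quotient.eq _).2 ?_).symm⟩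
    exact ha
  have hk : LinearMap.ker g = K := by
    ext a
    rw [← h₃]
    exact Submodule.Quotient.mk_eq_zero _
  exact ⟨(g.quotKerEquivOfSurjective hg).symm.trans (Submodule.quotEquivOfEq _ _ hk)⟩

/-- The submodules of `P_Y` that have a finite filtration by standard modules `Δ_Z`, `Z > Y`. -/
def HasFiltration {Γ : Type v} [Ring Γ] {Φ : Type} [PartialOrder Φ] (S : SimpleLabelling Γ Φ)
    (Y : Φ) (N : Submodule Γ (S.P Y)) : Prop :=
  ∃ (n : ℕ) (F : ℕ → Submodule Γ (S.P Y)), F 0 = ⊥ ∧ F n = N ∧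
    ∀ i < n, F i ≤ F (i + 1) ∧
      ∃ Z : Φ, Y < Z ∧ Nonempty ((F (i + 1) ⧸ (F i).submoduleOf (F (i + 1))) ≃ₗ[Γ] S.Delta Z)

theorem HasFiltration.extend {Γ : Type v} [Ring Γ] {Φ : Type} [PartialOrder Φ]
    {S : SimpleLabelling Γ Φ} {Y Z : Φ} {N N' : Submodule Γ (S.P Y)} (h : HasFiltration S Y N)
    (hle : N ≤ N') (hZ : Y < Z)
    (e : Nonempty ((N' ⧸ N.submoduleOf N') ≃ₗ[Γ] S.Delta Z)) : HasFiltration S Y N' := by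
  obtain ⟨n, F, h0, rfl, hF⟩ := h
  refine ⟨n + 1, Function.update F (n + 1) N', ?_, by simp, fun i hi => ?_⟩
  · rw [Function.update_of_ne (by lia), h0]
  · rcases Nat.lt_succ_iff_lt_or_eq.1 hi with hi | rfl
    · rw [Function.update_of_ne (by lia), Function.update_of_ne (by lia)]
      exact hF i hi
    · rw [Function.update_of_ne (by lia), Function.update_self]
      exact ⟨hle, Z, hZ, e⟩

omit [IsLengthCategory C] in
theorem isSummand_or_of_biprod [IsLengthCategory C] {W A B : C} (lam : LengthFunction C)
    (hW : Indecomposable W) (h : IsSummand W (A ⊞ B)) : IsSummand W A ∨ IsSummand W B := by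
  obtain ⟨i, p, h⟩ := isSummand_iff.1 h
  have h1 : IsIso ((i ≫ biprod.fst) ≫ biprod.inl ≫ p + (i ≫ biprod.snd) ≫ biprod.inr ≫ p) := by
    have : (i ≫ biprod.fst) ≫ biprod.inl ≫ p + (i ≫ biprod.snd) ≫ biprod.inr ≫ p =
        i ≫ (biprod.fst ≫ biprod.inl + biprod.snd ≫ biprod.inr) ≫ p := by
      simp only [Preadditive.add_comp, Preadditive.comp_add, Category.assoc]
    rw [this, biprod.total, Category.id_comp, h]
    infer_instance
  have h2 : ∀ {D : C} (a : W ⟶ D) (b : D ⟶ W), IsIso (a ≫ b) → IsSummand W D :=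
    fun a b hab => isSummand_iff.2 ⟨a, b ≫ inv (a ≫ b), by
      rw [← Category.assoc]; exact IsIso.hom_inv_id _⟩
  exact (hW.isIso_or_isIso_of_add lam _ _ h1).imp (h2 _ _) (h2 _ _)

omit [IsLengthCategory C] in
theorem range_precomp_comp_le {Y V W : C} (v : Y ⟶ V) (w : V ⟶ W) :
    LinearMap.range (precomp E (v ≫ w)) ≤ LinearMap.range (precomp E v) := by
  rintro _ ⟨f, rfl⟩
  exact ⟨w ≫ f, by simp⟩

omit [IsLengthCategory C] in
theorem nonempty_range_quotient_equiv {Y V W V₁ : C} (v : Y ⟶ V) [Epi v] (e : V ≅ W ⊞ V₁) :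
    Nonempty ((LinearMap.range (precomp E v) ⧸
      (LinearMap.range (precomp E (v ≫ e.hom ≫ biprod.map (L.q W) (𝟙 V₁)))).submoduleOf
        (LinearMap.range (precomp E v))) ≃ₗ[End E] (W ⟶ E) ⧸ lowerHom L W) := by
  refine nonempty_quotient_equiv (precomp E (v ≫ e.hom ≫ biprod.fst)) ?_ ?_ ?_
  · intro f
    exact ⟨e.hom ≫ biprod.fst ≫ f, by simp⟩
  · rintro _ ⟨f, rfl⟩
    refine ⟨biprod.inl ≫ e.inv ≫ f, biprod.snd ≫ biprod.inr ≫ e.inv ≫ f, ?_⟩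
    have h1 : v ≫ f = v ≫ e.hom ≫ biprod.fst ≫ biprod.inl ≫ e.inv ≫ f +
        v ≫ e.hom ≫ biprod.snd ≫ biprod.inr ≫ e.inv ≫ f := by
      calc v ≫ f = v ≫ e.hom ≫ (biprod.fst ≫ biprod.inl + biprod.snd ≫ biprod.inr) ≫ e.inv ≫ f := by
            rw [biprod.total]; simp
        _ = _ := by simp only [Preadditive.add_comp, Preadditive.comp_add, Category.assoc]
    simp only [precomp_apply, Category.assoc, biprod.map_snd_assoc, Category.id_comp]
    rw [h1, add_sub_cancel_left]
  · intro f
    constructor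
    · rintro ⟨g, hg⟩
      simp only [precomp_apply, Category.assoc] at hg
      have h1 : biprod.map (L.q W) (𝟙 V₁) ≫ g = biprod.fst ≫ f := by
        rw [← cancel_epi e.hom, ← cancel_epi v]; exact hg
      refine ⟨biprod.inl ≫ g, ?_⟩
      have h2 : biprod.inl ≫ biprod.map (L.q W) (𝟙 V₁) ≫ g = f := by rw [h1]; simp
      rwa [biprod.inl_map_assoc] at h2
    · rintro ⟨g, rfl⟩
      exact ⟨biprod.fst ≫ g, by simp⟩

theorem hasFiltration_range (φ : T.Φ) (V : C) :
    ∀ (v : T.obj φ ⟶ V), Epi v → IsAddRetract E V →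
      (∀ W, Indecomposable W → IsSummand W V → L.lay (T.obj φ) < L.lay W) →
      letI := T.partialOrder L
      HasFiltration (T.labelling lam) φ (LinearMap.range (precomp E v)) := by
  let := T.partialOrder L
  induction V using quotient_induction with
  | h V ih =>
    intro v hv hVE hVl
    by_cases hz : IsZero V
    · refine ⟨0, fun _ => ⊥, rfl, ?_, fun i hi => absurd hi (Nat.not_lt_zero i)⟩
      refine (LinearMap.range_eq_bot.2 (LinearMap.ext fun f => ?_)).symm
      exact (congrArg (v ≫ ·) (hz.eq_of_src f 0)).trans comp_zero
    obtain ⟨W, hW, hWV⟩ := exists_indec_summand hz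
    obtain ⟨ψ, ⟨e⟩⟩ := T.exists_iso W hW
      ((hVE.of_isSummand hWV).isSummand_of_indecomposable lam hW)
    have hψV : IsSummand (T.obj ψ) V := (IsSummand.of_iso e.symm).trans hWV
    have hlt := hVl _ (T.indec ψ) hψV
    obtain ⟨V₁, ⟨e⟩⟩ := hψV
    have hV₁ : IsSummand V₁ V := isSummand_iff.2
      ⟨biprod.inr ≫ e.inv, e.hom ≫ biprod.snd, by simp⟩
    let q : T.obj ψ ⊞ V₁ ⟶ L.Q (T.obj ψ) ⊞ V₁ := biprod.map (L.q (T.obj ψ)) (𝟙 V₁)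
    have hq : Epi q := biprod.map_epi _ _
    have hQl : ∀ W, Indecomposable W → IsSummand W (L.Q (T.obj ψ)) →
        L.lay (T.obj ψ) < L.lay W := fun W hW h =>
      L.lay_lt_of_isSummand_Q (T.indec ψ) (T.isSummand ψ) hW h
    have hniso : ¬ IsIso (e.hom ≫ q) := by
      intro h
      have h1 : IsIso q := by
        have : q = e.inv ≫ e.hom ≫ q := by simp
        rw [this]; infer_instance
      have h2 : IsIso (L.q (T.obj ψ)) := isIso_left_of_isIso_biprod_map (L.q (T.obj ψ)) (𝟙 V₁)
      exact (hQl _ (T.indec ψ) (IsSummand.of_iso (asIso (L.q (T.obj ψ))))).false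
    have hfil := ih (L.Q (T.obj ψ) ⊞ V₁) (e.hom ≫ q) inferInstance hniso (v ≫ e.hom ≫ q)
      inferInstance
      ((L.isAddRetract_Q (T.indec ψ) (T.isSummand ψ)).biprod (hVE.of_isSummand hV₁))
      (fun W hW hWQ => (isSummand_or_of_biprod lam hW hWQ).elim (fun h => hlt.trans (hQl W hW h))
        fun h => hVl W hW (h.trans hV₁))
    refine hfil.extend (Z := ψ) ?_ ((T.lt_iff L).2 hlt) ?_
    · exact range_precomp_comp_le v (e.hom ≫ q)
    · exact (nonempty_range_quotient_equiv L v e).map fun e =>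
        e.trans (Submodule.quotEquivOfEq _ _ (labelling_U lam L T ψ).symm)

omit [IsLengthCategory C] in
theorem surjective_of_ne_zero_standard {Y : C} (hY : Indecomposable Y) (hYE : IsSummand Y E)
    (f : (Y ⟶ E) →ₗ[End E] ((Y ⟶ E) ⧸ lowerHom L Y)) (hf : f ≠ 0) : Function.Surjective f := by
  obtain ⟨k, rfl⟩ := hYE.isAddRetract.exists_lift f
  by_cases hiso : IsIso k
  · exact (lowerHom L Y).mkQ_surjective.comp (precomp_surjective E k)
  · refine absurd (LinearMap.ext fun g => ?_) hf
    exact (Submodule.Quotient.mk_eq_zero _).2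
      (precomp_mem_lowerHom L hY hYE hY hYE le_rfl k hiso g)

theorem isQuasihereditary_labelling :
    letI := T.partialOrder L
    (T.labelling lam).IsQuasihereditary := by
  let := T.partialOrder L
  intro φ
  have hU := labelling_U lam L T φ
  refine ⟨?_, fun f hf => ?_⟩
  · have h := hasFiltration_range lam L T φ _ (L.q (T.obj φ)) inferInstance
      (L.isAddRetract_Q (T.indec φ) (T.isSummand φ))
      (fun W hW h => L.lay_lt_of_isSummand_Q (T.indec φ) (T.isSummand φ) hW h)
    change HasFiltration (T.labelling lam) φ ((T.labelling lam).U φ)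
    rw [hU]
    exact h
  · let e : (T.labelling lam).Delta φ ≃ₗ[End E] (T.obj φ ⟶ E) ⧸ lowerHom L (T.obj φ) :=
      Submodule.quotEquivOfEq _ _ hU
    have h := surjective_of_ne_zero_standard L (T.indec φ) (T.isSummand φ) (e.toLinearMap ∘ₗ f)
      fun h => hf (LinearMap.ext fun x => e.injective
        ((LinearMap.congr_fun h x).trans (map_zero e).symm))
    intro y
    obtain ⟨x, hx⟩ := h (e y)
    exact ⟨x, e.injective hx⟩

omit [IsLengthCategory C] in
theorem hasProjectiveDimensionLT_standard {Y : C} (hY : Indecomposable Y) (hYE : IsSummand Y E) :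
    HasProjectiveDimensionLT (ModuleCat.of (End E) ((Y ⟶ E) ⧸ lowerHom L Y)) 2 := by
  have := hYE.isAddRetract.projective
  have := (L.isAddRetract_Q hY hYE).projective
  exact hasProjectiveDimensionLT_right (precomp E (L.q Y)) (lowerHom L Y).mkQ
    (precomp_injective E _) (Submodule.mkQ_surjective _)
    (LinearMap.exact_map_mkQ_range _) (hasProjectiveDimensionLT_one_of_projective _)
    (hasProjectiveDimensionLT_one_of_projective _)

include lam L in
theorem isLeftStronglyQuasihereditary_of_layering : IsLeftStronglyQuasihereditary (End E) := by
  obtain ⟨T⟩ := exists_representatives lam E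
  refine ⟨isSemiprimaryRing_end lam L, T.Φ, T.partialOrder L, T.labelling lam,
    isQuasihereditary_labelling lam L T, fun φ => ?_⟩
  let e : ((T.obj φ ⟶ E) ⧸ lowerHom L (T.obj φ)) ≃ₗ[End E]
      letI := T.partialOrder L; (T.labelling lam).Delta φ :=
    Submodule.quotEquivOfEq _ _ (labelling_U lam L T φ).symm
  exact hasProjectiveDimensionLT_congr e
    (hasProjectiveDimensionLT_standard L (T.indec φ) (T.isSummand φ))

end Standard

section GlobalDimension

variable {C : Type u} [Category.{v} C] [Abelian C] [IsLengthCategory C] (lam : LengthFunction C)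
  {E : C} {ℓ : ℕ} (L : Layering E ℓ)

/-- No indecomposable summand of `E` in a layer outside `S` contributes to the module `M`. -/
def SupportedIn (S : Set ℕ) (M : Type v) [AddCommGroup M] [Module (End E) M] : Prop :=
  ∀ Z : C, Indecomposable Z → IsSummand Z E → L.lay Z ∉ S →
    ∀ f : (Z ⟶ E) →ₗ[End E] M, f = 0

include lam in
theorem hasProjectiveDimensionLE_of_supportedIn {S : Set ℕ} {n : ℕ}
    (h : ∀ Z : C, Indecomposable Z → IsSummand Z E → L.lay Z ∈ S →
      HasProjectiveDimensionLE (ModuleCat.of (End E) (moduleTop (End E) (Z ⟶ E))) n)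
    {M : Type v} [AddCommGroup M] [Module (End E) M] (hM : SupportedIn L S M) :
    HasProjectiveDimensionLE (ModuleCat.of (End E) M) n := by
  have := isSemiprimaryRing_end lam L
  refine hasProjectiveDimensionLE_of_simple (R := End E) (Q := fun M _ _ => SupportedIn L S M)
    ?_ ?_ ?_ M hM
  · intro M N _ _ _ _ f hf hN Z hZ hZE hS g
    refine LinearMap.ext fun x => hf ?_
    rw [LinearMap.zero_apply, map_zero]
    exact LinearMap.congr_fun (hN Z hZ hZE hS (f ∘ₗ g)) x
  · intro M N _ _ _ _ f hf hM Z hZ hZE hS g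
    have := hZE.isAddRetract.projective
    obtain ⟨g', rfl⟩ := Module.projective_lifting_property f g hf
    rw [hM Z hZ hZE hS g', LinearMap.comp_zero]
  · intro A _ _ hA hAS
    obtain ⟨Z, hZ, hZE, ⟨e⟩⟩ := exists_indec_top_equiv_of_simple lam A hA
    refine hasProjectiveDimensionLT_congr e.symm (h Z hZ hZE ?_)
    by_contra hS
    have h0 := hAS Z hZ hZE hS (e.symm.toLinearMap ∘ₗ (Module.jacobson (End E) (Z ⟶ E)).mkQ)
    refine (isCoatom_jacobson lam hZ hZE).1 (eq_top_iff.2 fun f _ => ?_)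
    have := LinearMap.congr_fun h0 f
    simpa using this

include lam in
theorem hasProjectiveDimensionLE_top_of_indecomposable {Y : C} (hY : Indecomposable Y)
    (hYE : IsSummand Y E) :
    HasProjectiveDimensionLE (ModuleCat.of (End E) (moduleTop (End E) (Y ⟶ E)))
      (L.lay Y + 1) := by
  induction hn : L.lay Y using Nat.strong_induction_on generalizing Y with
  | h n ih =>
    subst hn
    let J := Module.jacobson (End E) (Y ⟶ E)
    let U := lowerHom L Y
    have hUtop : U ≠ ⊤ := by
      intro h
      obtain ⟨i, p, hip⟩ := isSummand_iff.1 hYE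
      obtain ⟨g, hg⟩ : i ∈ U := h ▸ Submodule.mem_top
      rw [precomp_apply] at hg
      have hs : IsSummand Y (L.Q Y) := isSummand_iff.2 ⟨L.q Y, g ≫ p, by
        rw [← Category.assoc, hg, hip]⟩
      exact (L.lay_lt_of_isSummand_Q hY hYE hY hs).false
    have hUJ : U ≤ J := by
      rw [show J = _ from jacobson_eq_nonSplit lam hY hYE]
      exact le_nonSplit lam hY hUtop
    let N : Submodule (End E) ((Y ⟶ E) ⧸ U) := J.map U.mkQ
    have hN : HasProjectiveDimensionLE (ModuleCat.of (End E) N) (L.lay Y) := by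
      refine hasProjectiveDimensionLE_of_supportedIn lam L (S := Set.Iio (L.lay Y)) ?_ ?_
      · intro Z hZ hZE hlt
        have := ih _ hlt hZ hZE rfl
        exact hasProjectiveDimensionLT_of_ge _ (L.lay Z + 1 + 1) _ (by
          have : L.lay Z < L.lay Y := hlt
          lia)
      · intro Z hZ hZE hle f
        obtain ⟨k, hk⟩ := hZE.isAddRetract.exists_lift (Y := Y) (N := U) (N.subtype ∘ₗ f)
        have hle' : L.lay Y ≤ L.lay Z := not_lt.1 hle
        by_cases hiso : IsIso k
        · exfalso
          refine (isCoatom_jacobson lam hY hYE).1 (eq_top_iff.2 fun g _ => ?_)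
          obtain ⟨g, rfl⟩ := precomp_surjective E k g
          have h1 : U.mkQ (precomp E k g) ∈ N := by
            have := LinearMap.congr_fun hk g
            exact this ▸ (f g).2
          obtain ⟨j, hj, hje⟩ := h1
          have h2 : j - precomp E k g ∈ U := (Submodule.Quotient.eq _).1 hje
          have h3 := J.sub_mem hj (hUJ h2)
          rwa [sub_sub_cancel] at h3
        · refine LinearMap.ext fun g => Subtype.ext ((LinearMap.congr_fun hk g).trans ?_)
          exact (Submodule.Quotient.mk_eq_zero _).2
            (precomp_mem_lowerHom L hY hYE hZ hZE hle' k hiso g)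
    have hD := hasProjectiveDimensionLT_standard L hY hYE
    have hQ := hasProjectiveDimensionLT_right N.subtype N.mkQ N.injective_subtype
      N.mkQ_surjective (LinearMap.exact_subtype_mkQ N) hN
      (hasProjectiveDimensionLT_of_ge _ 2 (L.lay Y + 1 + 1) (by lia))
    exact hasProjectiveDimensionLT_congr (Submodule.quotientQuotientEquivQuotient U J hUJ) hQ

include lam L in
theorem globalDimensionLE_of_layering : GlobalDimensionLE (End E) ℓ := fun M => by
  refine hasProjectiveDimensionLE_of_supportedIn lam L (S := Set.univ) (M := M) ?_ ?_
  · intro Z hZ hZE _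
    have := hasProjectiveDimensionLE_top_of_indecomposable lam L hZ hZE
    have hlt := L.lay_lt hZ hZE
    exact hasProjectiveDimensionLT_of_ge _ (L.lay Z + 1 + 1) _ (by lia)
  · intro Z _ _ h
    exact absurd (Set.mem_univ _) h

include lam in
theorem hasProjectiveDimensionLE_homTop {Y : C} (hY : IsAddRetract E Y) {i : ℕ}
    (hi : ∀ W : C, Indecomposable W → IsSummand W Y → L.lay W = i) :
    HasProjectiveDimensionLE (homTop Y E) (i + 1) := by
  refine hasProjectiveDimensionLE_of_supportedIn lam L (S := {i}) ?_ ?_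
  · rintro Z hZ hZE rfl
    exact hasProjectiveDimensionLE_top_of_indecomposable lam L hZ hZE
  · intro Z hZ hZE hne f
    obtain ⟨k, rfl⟩ := hZE.isAddRetract.exists_lift f
    refine LinearMap.ext fun g => (Submodule.Quotient.mk_eq_zero _).2 ?_
    obtain ⟨d⟩ := exists_indecDecomposition Y
    have hg : precomp E k g = ∑ j, precomp E (d.π j) ((d.ι j ≫ k) ≫ g) := by
      calc k ≫ g = (∑ j, d.π j ≫ d.ι j) ≫ k ≫ g := by rw [d.total, Category.id_comp]
        _ = _ := by simp only [Preadditive.sum_comp, Category.assoc, precomp_apply]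
    rw [hg]
    refine Submodule.sum_mem _ fun j _ => ?_
    have hjE := (hY.of_isSummand (d.isSummand j)).isSummand_of_indecomposable lam (d.indec j)
    refine Module.le_comap_jacobson (precomp E (d.π j))
      (comp_mem_jacobson lam (d.indec j) hjE hZ (d.ι j ≫ k) (fun h => hne ?_) g)
    exact (L.lay_iso hZ (asIso (d.ι j ≫ k))).symm.trans (hi _ (d.indec j) (d.isSummand j))

end GlobalDimension

end GabrielRoiter

theorem mainTheorem1 {C : Type u} [Category.{v} C] [Abelian C]
    [GabrielRoiter.IsLengthCategory C] (lam : GabrielRoiter.LengthFunction C) (X : C) :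
    (∀ i : ℕ, IsZero (GabrielRoiter.quotientSeq lam X i) ↔ GabrielRoiter.numNonzero lam X ≤ i) ∧
    GabrielRoiter.IsLeftStronglyQuasihereditary (End (GabrielRoiter.totalObject lam X)) ∧
    GabrielRoiter.GlobalDimensionLE (End (GabrielRoiter.totalObject lam X))
      (GabrielRoiter.numNonzero lam X) ∧
    ∀ Y : C, GabrielRoiter.InAdd (GabrielRoiter.totalObject lam X) Y → ¬ IsZero Y →
      (∃! i : Fin (GabrielRoiter.numNonzero lam X),
        GabrielRoiter.grMeasure lam Y =
          GabrielRoiter.grMeasure lam (GabrielRoiter.quotientSeq lam X i)) ∧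
      ∀ i : Fin (GabrielRoiter.numNonzero lam X),
        GabrielRoiter.grMeasure lam Y =
          GabrielRoiter.grMeasure lam (GabrielRoiter.quotientSeq lam X i) →
        (∀ Z : C, Indecomposable Z → GabrielRoiter.IsSummand Z Y →
          GabrielRoiter.grMeasure lam Z = GabrielRoiter.grMeasure lam Y) →
        HasProjectiveDimensionLE
          (GabrielRoiter.homTop Y (GabrielRoiter.totalObject lam X)) ((i : ℕ) + 1) := by
  have hadd : ∀ {Y W : C}, GabrielRoiter.InAdd (GabrielRoiter.totalObject lam X) Y →
      Indecomposable W → GabrielRoiter.IsSummand W Y →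
      GabrielRoiter.layer lam X W < GabrielRoiter.numNonzero lam X ∧
        GabrielRoiter.indecMeasure lam W = GabrielRoiter.grMeasure lam
          (GabrielRoiter.quotientSeq lam X (GabrielRoiter.layer lam X W)) :=
    fun hY hW h => GabrielRoiter.layer_spec lam X hW
      ((hY.isAddRetract.of_isSummand h).isSummand_of_indecomposable lam hW)
  refine ⟨GabrielRoiter.isZero_quotientSeq_iff lam X,
    GabrielRoiter.isLeftStronglyQuasihereditary_of_layering lam (GabrielRoiter.layering lam X),
    GabrielRoiter.globalDimensionLE_of_layering lam (GabrielRoiter.layering lam X),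
    fun Y hY hYz => ⟨?_, fun i hi hsum => ?_⟩⟩
  · obtain ⟨W, hW, hWY, he⟩ := GabrielRoiter.exists_indecMeasure_eq_grMeasure lam hYz
    obtain ⟨h1, h2⟩ := hadd hY hW hWY
    refine ⟨⟨_, h1⟩, he.symm.trans h2, fun j hj => Fin.ext ?_⟩
    exact GabrielRoiter.eq_of_grMeasure_quotientSeq_eq lam X j.2 h1
      (hj.symm.trans (he.symm.trans h2))
  · refine GabrielRoiter.hasProjectiveDimensionLE_homTop lam (GabrielRoiter.layering lam X)
      hY.isAddRetract fun W hW hWY => ?_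
    obtain ⟨h1, h2⟩ := hadd hY hW hWY
    refine GabrielRoiter.eq_of_grMeasure_quotientSeq_eq lam X h1 i.2 ?_
    refine h2.symm.trans ?_
    rw [← GabrielRoiter.grMeasure_eq_indecMeasure lam hW, hsum W hW hWY, hi]
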